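/- **Proposition.** Let $\psi\colon[0,\infty)\to[0,\infty)$ be an Orlicz function, i.e. a nondecreasing convex function with $\psi(0)=0$ and $\psi(x)\to\infty$ as $x\to\infty$. Suppose that $\psi$ does not satisfy the $\Delta_2$-condition, i.e. $\psi(2x)/\psi(x)$ does not remain bounded as $x\to\infty$ (there are no constants $C,x_0$ with $\psi(2x)\le C\,\psi(x)$ for all $x\ge x_0$). For a probability space $(\Omega,\mathbb P)$ and a measurable $f\colon\Omega\to\mathbb C$ put $$\|f\|_{L^\psi(\mathbb P)}=\inf\Big\{K>0:\ \int_\Omega\psi(|f|/K)\,d\mathbb P\le 1\Big\}\in[0,\infty].$$ Let $\mathbb D$ be the open unit disc, $A$ the normalized area measure on $\mathbb D$, $m$ the normalized Lebesgue measure on the unit circle, and $f_r(e^{it})=f(re^{it})$. Let $$H^\psi=\Big\{f \text{ holomorphic on } \mathbb D:\ \|f\|_{H^\psi}:=\sup_{0<r<1}\|f_r\|_{L^\psi(m)}<\infty\Big\},$$ $$B^\psi=\Big\{f \text{ holomorphic on } \mathbb D:\ \|f\|_{B^\psi}:=\|f\|_{L^\psi(A)}<\infty\Big\}$$ be the Hardy–Orlicz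 and Bergman–Orlicz spaces, normed by $\|\cdot\|_{H^\psi}$ and $\|\cdot\|_{B^\psi}$. Then neither $H^\psi$ nor $B^\psi$ is reflexive. -/

import Mathlib

open Set MeasureTheory Filter Topology
open scoped NNReal ENNReal

noncomputable section

/-- An Orlicz function: a nondecreasing convex function `ψ : [0, ∞) → [0, ∞)` with `ψ 0 = 0` and
`ψ x → ∞` as `x → ∞`. -/
structure OrliczFunction where
  toFun : ℝ≥0 → ℝ≥0
  monotone_toFun : Monotone toFun
  convexOn_toFun : ConvexOn ℝ≥0 univ toFun
  map_zero : toFun 0 = 0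
  tendsto_atTop : Tendsto toFun atTop atTop

namespace OrliczFunction

instance : CoeFun OrliczFunction (fun _ => ℝ≥0 → ℝ≥0) := ⟨toFun⟩

/-- The `Δ₂`-condition: `ψ (2x) / ψ x` remains bounded as `x → ∞`. -/
def DeltaTwo (ψ : OrliczFunction) : Prop :=
  ∃ C x₀ : ℝ≥0, ∀ x, x₀ ≤ x → ψ (2 * x) ≤ C * ψ x

/-- The modular `∫ ψ (|f| / K) dμ`, with values in `[0, ∞]`. -/
def modular {Ω : Type*} [MeasurableSpace Ω] (ψ : OrliczFunction) (μ : Measure Ω)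
    (f : Ω → ℂ) (K : ℝ≥0) : ℝ≥0∞ :=
  ∫⁻ ω, (ψ (‖f ω‖₊ / K) : ℝ≥0∞) ∂μ

/-- The Luxemburg norm `inf {K > 0 : ∫ ψ (|f| / K) dμ ≤ 1}`, with values in `[0, ∞]`
(it is `∞` when no such `K` exists). -/
def luxemburg {Ω : Type*} [MeasurableSpace Ω] (ψ : OrliczFunction) (μ : Measure Ω)
    (f : Ω → ℂ) : ℝ≥0∞ :=
  ⨅ (K : ℝ≥0) (_ : 0 < K ∧ ψ.modular μ f K ≤ 1), (K : ℝ≥0∞)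

section Luxemburg

variable {Ω : Type*} [MeasurableSpace Ω] (ψ : OrliczFunction) (μ : Measure Ω)

theorem measurable_toFun : Measurable ψ := ψ.monotone_toFun.measurable

theorem exists_of_luxemburg_lt {f : Ω → ℂ} {c : ℝ≥0∞} (h : ψ.luxemburg μ f < c) :
    ∃ K : ℝ≥0, 0 < K ∧ ψ.modular μ f K ≤ 1 ∧ (K : ℝ≥0∞) < c := by
  simp only [luxemburg, iInf_lt_iff] at h
  obtain ⟨K, ⟨h1, h2⟩, h3⟩ := h
  exact ⟨K, h1, h2, h3⟩

theorem luxemburg_le {f : Ω → ℂ} {K : ℝ≥0} (hK : 0 < K) (h : ψ.modular μ f K ≤ 1) :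
    ψ.luxemburg μ f ≤ K :=
  iInf₂_le K ⟨hK, h⟩

theorem luxemburg_zero : ψ.luxemburg μ (fun _ => 0) = 0 := by
  refine le_antisymm (ENNReal.le_of_forall_pos_le_add fun ε hε _ => ?_) (zero_le)
  rw [zero_add]
  exact ψ.luxemburg_le μ hε (by simp [modular, ψ.map_zero])

theorem luxemburg_add_le {f g : Ω → ℂ} (hf : AEMeasurable f μ) :
    ψ.luxemburg μ (fun ω => f ω + g ω) ≤ ψ.luxemburg μ f + ψ.luxemburg μ g := by
  rcases eq_or_ne (ψ.luxemburg μ f) ⊤ with h | hF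
  · simp [h]
  rcases eq_or_ne (ψ.luxemburg μ g) ⊤ with h | hG
  · simp [h]
  refine ENNReal.le_of_forall_pos_le_add fun ε hε _ => ?_
  have hε2 : ((ε / 2 : ℝ≥0) : ℝ≥0∞) ≠ 0 := by simpa using hε.ne'
  obtain ⟨K, hK, hKf, hK'⟩ := ψ.exists_of_luxemburg_lt μ (ENNReal.lt_add_right hF hε2)
  obtain ⟨L, hL, hLg, hL'⟩ := ψ.exists_of_luxemburg_lt μ (ENNReal.lt_add_right hG hε2)
  have hKL : 0 < K + L := add_pos hK hL
  have hab : K / (K + L) + L / (K + L) = 1 := by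
    rw [← add_div, div_self hKL.ne']
  have key : ψ.modular μ (fun ω => f ω + g ω) (K + L) ≤ 1 := by
    have hpt : ∀ ω, (ψ (‖f ω + g ω‖₊ / (K + L)) : ℝ≥0∞) ≤
        ((K / (K + L) : ℝ≥0) : ℝ≥0∞) * (ψ (‖f ω‖₊ / K) : ℝ≥0∞) +
        ((L / (K + L) : ℝ≥0) : ℝ≥0∞) * (ψ (‖g ω‖₊ / L) : ℝ≥0∞) := by
      intro ω
      have h1 : ‖f ω + g ω‖₊ / (K + L) ≤
          (K / (K + L)) * (‖f ω‖₊ / K) + (L / (K + L)) * (‖g ω‖₊ / L) := by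
        have : (K / (K + L)) * (‖f ω‖₊ / K) + (L / (K + L)) * (‖g ω‖₊ / L)
            = (‖f ω‖₊ + ‖g ω‖₊) / (K + L) := by
          field_simp
        rw [this]
        gcongr
        exact nnnorm_add_le _ _
      have h2 := ψ.convexOn_toFun.2 (mem_univ (‖f ω‖₊ / K)) (mem_univ (‖g ω‖₊ / L))
        (zero_le) (zero_le) hab
      simp only [smul_eq_mul] at h2
      exact_mod_cast (ψ.monotone_toFun h1).trans h2
    have hm : AEMeasurable (fun ω => ((K / (K + L) : ℝ≥0) : ℝ≥0∞) *
        (ψ (‖f ω‖₊ / K) : ℝ≥0∞)) μ :=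
      ((ψ.measurable_toFun.comp_aemeasurable (hf.nnnorm.div_const K)).coe_nnreal_ennreal).const_mul _
    calc ψ.modular μ (fun ω => f ω + g ω) (K + L)
        ≤ ∫⁻ ω, (((K / (K + L) : ℝ≥0) : ℝ≥0∞) * (ψ (‖f ω‖₊ / K) : ℝ≥0∞) +
          ((L / (K + L) : ℝ≥0) : ℝ≥0∞) * (ψ (‖g ω‖₊ / L) : ℝ≥0∞)) ∂μ := lintegral_mono hpt
      _ = ((K / (K + L) : ℝ≥0) : ℝ≥0∞) * ψ.modular μ f K +
          ((L / (K + L) : ℝ≥0) : ℝ≥0∞) * ψ.modular μ g L := by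
        rw [lintegral_add_left' hm, lintegral_const_mul' _ _ ENNReal.coe_ne_top,
          lintegral_const_mul' _ _ ENNReal.coe_ne_top]
        rfl
      _ ≤ ((K / (K + L) : ℝ≥0) : ℝ≥0∞) * 1 + ((L / (K + L) : ℝ≥0) : ℝ≥0∞) * 1 := by gcongr
      _ = 1 := by rw [mul_one, mul_one, ← ENNReal.coe_add, hab, ENNReal.coe_one]
  calc ψ.luxemburg μ (fun ω => f ω + g ω) ≤ ((K + L : ℝ≥0) : ℝ≥0∞) := ψ.luxemburg_le μ hKL key
    _ = K + L := by push_cast; rfl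
    _ ≤ (ψ.luxemburg μ f + (ε / 2 : ℝ≥0)) + (ψ.luxemburg μ g + (ε / 2 : ℝ≥0)) := by gcongr
    _ = ψ.luxemburg μ f + ψ.luxemburg μ g + ((ε / 2 + ε / 2 : ℝ≥0) : ℝ≥0∞) := by
      push_cast; ring
    _ = ψ.luxemburg μ f + ψ.luxemburg μ g + ε := by rw [add_halves]

theorem luxemburg_smul_le (c : ℂ) (f : Ω → ℂ) :
    ψ.luxemburg μ (fun ω => c * f ω) ≤ (‖c‖₊ : ℝ≥0∞) * ψ.luxemburg μ f := by
  rcases eq_or_ne c 0 with rfl | hc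
  · simp [luxemburg_zero]
  have hc' : (‖c‖₊ : ℝ≥0∞) ≠ 0 := by simpa using hc
  rw [mul_comm, ← ENNReal.div_le_iff_le_mul (Or.inl hc') (Or.inl ENNReal.coe_ne_top)]
  refine le_of_forall_gt fun b hb => ?_
  obtain ⟨K, hK, hKf, hK'⟩ := ψ.exists_of_luxemburg_lt μ hb
  refine lt_of_le_of_lt ?_ hK'
  rw [ENNReal.div_le_iff_le_mul (Or.inl hc') (Or.inl ENNReal.coe_ne_top), mul_comm,
    ← ENNReal.coe_mul]
  have hc0 : 0 < ‖c‖₊ := by simpa using hc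
  refine ψ.luxemburg_le μ (mul_pos hc0 hK) ?_
  refine le_of_eq_of_le ?_ hKf
  simp only [modular, nnnorm_mul]
  refine lintegral_congr fun ω => ?_
  rw [mul_div_mul_left _ _ hc0.ne']

theorem ae_eq_zero_of_luxemburg_eq_zero {f : Ω → ℂ} (hf : AEMeasurable f μ)
    (h : ψ.luxemburg μ f = 0) : f =ᵐ[μ] fun _ => 0 := by
  have hmod : ∀ k : ℝ≥0, 0 < k → ψ.modular μ f k ≤ 1 := by
    intro k hk
    have : ψ.luxemburg μ f < (k : ℝ≥0∞) := by rw [h]; exact_mod_cast hk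
    obtain ⟨K, hK, hKf, hK'⟩ := ψ.exists_of_luxemburg_lt μ this
    refine le_trans (lintegral_mono fun ω => ?_) hKf
    have hKk : K ≤ k := by exact_mod_cast hK'.le
    have h1 : ‖f ω‖₊ / k ≤ ‖f ω‖₊ / K := by gcongr
    exact ENNReal.coe_le_coe.2 (ψ.monotone_toFun h1)
  have hlevel : ∀ n : ℕ, μ {ω | (1 / ((n : ℝ≥0) + 1)) ≤ ‖f ω‖₊} = 0 := by
    intro n
    set δ : ℝ≥0 := 1 / ((n : ℝ≥0) + 1) with hδ
    have hδ0 : 0 < δ := by positivity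
    by_contra hne
    set a := μ {ω | δ ≤ ‖f ω‖₊} with ha
    have hbound : ∀ M : ℝ≥0, (M : ℝ≥0∞) * a ≤ 1 := by
      intro M
      obtain ⟨x, hx⟩ := ((ψ.tendsto_atTop.eventually_ge_atTop M).and
        (eventually_gt_atTop 0)).exists
      have hk : 0 < δ / x := div_pos hδ0 hx.2
      have hm : AEMeasurable (fun ω => (ψ (‖f ω‖₊ / (δ / x)) : ℝ≥0∞)) μ :=
        (ψ.measurable_toFun.comp_aemeasurable (hf.nnnorm.div_const _)).coe_nnreal_ennreal
      refine le_trans ?_ (hmod (δ / x) hk)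
      refine le_trans ?_ (mul_meas_ge_le_lintegral₀ hm (M : ℝ≥0∞))
      gcongr
      refine measure_mono fun ω hω => ?_
      have h1 : x ≤ ‖f ω‖₊ / (δ / x) := by
        rw [le_div_iff₀ hk, mul_div_cancel₀ _ hx.2.ne']
        exact hω
      show (M : ℝ≥0∞) ≤ (ψ (‖f ω‖₊ / (δ / x)) : ℝ≥0∞)
      exact_mod_cast hx.1.trans (ψ.monotone_toFun h1)
    have ha1 : a ≤ 1 := by simpa using hbound 1
    have hatop : a ≠ ⊤ := ne_top_of_le_ne_top ENNReal.one_ne_top ha1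
    have hb := hbound (2 / a.toNNReal)
    have ha0 : a.toNNReal ≠ 0 := by
      simp [ENNReal.toNNReal_eq_zero_iff, hne, hatop]
    rw [← ENNReal.coe_toNNReal hatop, ← ENNReal.coe_mul] at hb
    simp only [ENNReal.toNNReal_coe] at hb
    rw [div_mul_cancel₀ _ ha0] at hb
    have : (2 : ℝ≥0) ≤ 1 := by exact_mod_cast hb
    norm_num at this
  have hU : μ (⋃ n : ℕ, {ω | (1 / ((n : ℝ≥0) + 1)) ≤ ‖f ω‖₊}) = 0 :=
    measure_iUnion_null hlevel
  refine measure_mono_null (fun ω hω => ?_) hU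
  have hω' : 0 < ‖f ω‖ := by simpa using hω
  obtain ⟨n, hn⟩ := exists_nat_one_div_lt hω'
  refine mem_iUnion.2 ⟨n, ?_⟩
  show (1 / ((n : ℝ≥0) + 1)) ≤ ‖f ω‖₊
  exact_mod_cast hn.le

end Luxemburg

end OrliczFunction

/-- The holomorphic functions on the open unit disc, each represented by its unique extension
to `ℂ` that vanishes outside the disc. -/
def holomorphicDisc : Submodule ℂ (ℂ → ℂ) where
  carrier := {f | DifferentiableOn ℂ f (Metric.ball 0 1) ∧ ∀ z, z ∉ Metric.ball (0 : ℂ) 1 → f z = 0}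
  add_mem' := fun hf hg => ⟨hf.1.add hg.1, fun z hz => by simp [hf.2 z hz, hg.2 z hz]⟩
  zero_mem' := ⟨differentiableOn_const 0, fun _ _ => rfl⟩
  smul_mem' := fun c _ hf => ⟨hf.1.const_smul c, fun z hz => by simp [hf.2 z hz]⟩

/-- The normalized Lebesgue measure on the unit circle, parametrized by `t ∈ (0, 2π]`. -/
def circleMeasure : Measure ℝ :=
  ENNReal.ofReal (1 / (2 * Real.pi)) • volume.restrict (Ioc 0 (2 * Real.pi))

/-- The normalized area measure on the open unit disc. -/
def discMeasure : Measure ℂ :=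
  ENNReal.ofReal (1 / Real.pi) • volume.restrict (Metric.ball 0 1)

theorem holomorphicDisc.aemeasurable {f : ℂ → ℂ} (hf : f ∈ holomorphicDisc) :
    AEMeasurable f discMeasure :=
  (hf.1.continuousOn.aemeasurable Metric.isOpen_ball.measurableSet).smul_measure _

theorem holomorphicDisc.continuous_circle {f : ℂ → ℂ} (hf : f ∈ holomorphicDisc) {r : ℝ}
    (hr : r ∈ Ioo (0 : ℝ) 1) : Continuous fun t : ℝ => f (circleMap 0 r t) := by
  refine hf.1.continuousOn.comp_continuous (continuous_circleMap 0 r) fun t => ?_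
  simp [abs_of_pos hr.1, hr.2]

/-- The Hardy-Orlicz norm `sup_{0 < r < 1} ‖f_r‖_ψ`, where `f_r (e^{it}) = f (r e^{it})`,
with values in `[0, ∞]`. -/
def hardyOrliczENorm (ψ : OrliczFunction) (f : ℂ → ℂ) : ℝ≥0∞ :=
  ⨆ r ∈ Ioo (0 : ℝ) 1, ψ.luxemburg circleMeasure fun t => f (circleMap 0 r t)

/-- The Bergman-Orlicz norm `‖f‖_{L^ψ(A)}`, with values in `[0, ∞]`. -/
def bergmanOrliczENorm (ψ : OrliczFunction) (f : ℂ → ℂ) : ℝ≥0∞ :=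
  ψ.luxemburg discMeasure f

theorem hardyOrliczENorm_zero (ψ : OrliczFunction) : hardyOrliczENorm ψ 0 = 0 := by
  simp [hardyOrliczENorm, ψ.luxemburg_zero]

theorem hardyOrliczENorm_add_le (ψ : OrliczFunction) {f g : ℂ → ℂ} (hf : f ∈ holomorphicDisc) :
    hardyOrliczENorm ψ (f + g) ≤ hardyOrliczENorm ψ f + hardyOrliczENorm ψ g := by
  refine iSup₂_le fun r hr => ?_
  refine (ψ.luxemburg_add_le _
    (holomorphicDisc.continuous_circle hf hr).measurable.aemeasurable).trans ?_
  exact add_le_add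
    (le_iSup₂ (f := fun r (_ : r ∈ Ioo (0 : ℝ) 1) =>
      ψ.luxemburg circleMeasure fun t => f (circleMap 0 r t)) r hr)
    (le_iSup₂ (f := fun r (_ : r ∈ Ioo (0 : ℝ) 1) =>
      ψ.luxemburg circleMeasure fun t => g (circleMap 0 r t)) r hr)

theorem hardyOrliczENorm_smul_le (ψ : OrliczFunction) (c : ℂ) (f : ℂ → ℂ) :
    hardyOrliczENorm ψ (c • f) ≤ (‖c‖₊ : ℝ≥0∞) * hardyOrliczENorm ψ f := by
  refine iSup₂_le fun r hr => (ψ.luxemburg_smul_le _ c _).trans ?_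
  gcongr
  exact le_iSup₂ (f := fun r (_ : r ∈ Ioo (0 : ℝ) 1) =>
      ψ.luxemburg circleMeasure fun t => f (circleMap 0 r t)) r hr

theorem hardyOrliczENorm_eq_zero (ψ : OrliczFunction) {f : ℂ → ℂ} (hf : f ∈ holomorphicDisc)
    (h : hardyOrliczENorm ψ f = 0) : f = 0 := by
  have hr0 : ∀ r ∈ Ioo (0 : ℝ) 1, ∀ t ∈ Ioc (0 : ℝ) (2 * Real.pi), f (circleMap 0 r t) = 0 := by
    intro r hr
    have hc := holomorphicDisc.continuous_circle hf hr
    have h1 : ψ.luxemburg circleMeasure (fun t => f (circleMap 0 r t)) = 0 := by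
      refine le_antisymm (le_trans ?_ h.le) (zero_le)
      exact le_iSup₂ (f := fun r (_ : r ∈ Ioo (0 : ℝ) 1) =>
        ψ.luxemburg circleMeasure fun t => f (circleMap 0 r t)) r hr
    have h2 := ψ.ae_eq_zero_of_luxemburg_eq_zero _ hc.measurable.aemeasurable h1
    have hpos : ENNReal.ofReal (1 / (2 * Real.pi)) ≠ 0 := by
      simp [Real.pi_pos]
    rw [circleMeasure, Filter.EventuallyEq, Measure.ae_ennreal_smul_measure_iff hpos] at h2
    exact Measure.eqOn_Ioc_of_ae_eq volume h2 hc.continuousOn continuousOn_const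
  have hne : ∀ z ∈ Metric.ball (0 : ℂ) 1, z ≠ 0 → f z = 0 := by
    intro z hz hz0
    have hzr : ‖z‖ ∈ Ioo (0 : ℝ) 1 := ⟨by simpa using hz0, by simpa using hz⟩
    have hex : z ∈ circleMap 0 ‖z‖ '' Ioc 0 (2 * Real.pi) := by
      rw [image_circleMap_Ioc]; simp
    obtain ⟨t, ht, hzt⟩ := hex
    rw [← hzt]; exact hr0 _ hzr t ht
  have h0 : f 0 = 0 := by
    have hcont : ContinuousAt f 0 :=
      hf.1.continuousOn.continuousAt (Metric.ball_mem_nhds 0 one_pos)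
    have ht : Tendsto f (𝓝[≠] 0) (𝓝 (f 0)) := hcont.tendsto.mono_left nhdsWithin_le_nhds
    have ht0 : Tendsto f (𝓝[≠] 0) (𝓝 0) := by
      refine tendsto_const_nhds.congr' ?_
      filter_upwards [self_mem_nhdsWithin,
        mem_nhdsWithin_of_mem_nhds (Metric.ball_mem_nhds (0 : ℂ) one_pos)] with z hz hz1
      exact (hne z hz1 hz).symm
    exact tendsto_nhds_unique ht ht0
  funext z
  by_cases hz : z ∈ Metric.ball (0 : ℂ) 1
  · rcases eq_or_ne z 0 with rfl | hz0
    · exact h0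
    · exact hne z hz hz0
  · exact hf.2 z hz

theorem bergmanOrliczENorm_eq_zero (ψ : OrliczFunction) {f : ℂ → ℂ} (hf : f ∈ holomorphicDisc)
    (h : bergmanOrliczENorm ψ f = 0) : f = 0 := by
  have h2 := ψ.ae_eq_zero_of_luxemburg_eq_zero _ (holomorphicDisc.aemeasurable hf) h
  have hpos : ENNReal.ofReal (1 / Real.pi) ≠ 0 := by
    simp [Real.pi_pos]
  rw [discMeasure, Filter.EventuallyEq, Measure.ae_ennreal_smul_measure_iff hpos] at h2
  have h3 := Measure.eqOn_open_of_ae_eq h2 Metric.isOpen_ball hf.1.continuousOn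
    continuousOn_const
  funext z
  by_cases hz : z ∈ Metric.ball (0 : ℂ) 1
  · exact h3 hz
  · exact hf.2 z hz

/-- The underlying vector space of `H^ψ`. -/
def hardyOrliczSubmodule (ψ : OrliczFunction) : Submodule ℂ (ℂ → ℂ) where
  carrier := {f | f ∈ holomorphicDisc ∧ hardyOrliczENorm ψ f < ⊤}
  add_mem' := fun hf hg => ⟨add_mem hf.1 hg.1,
    (hardyOrliczENorm_add_le ψ hf.1).trans_lt (ENNReal.add_lt_top.2 ⟨hf.2, hg.2⟩)⟩
  zero_mem' := ⟨zero_mem _, by simp [hardyOrliczENorm_zero]⟩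
  smul_mem' := fun c _ hf => ⟨Submodule.smul_mem _ c hf.1,
    (hardyOrliczENorm_smul_le ψ c _).trans_lt (ENNReal.mul_lt_top ENNReal.coe_lt_top hf.2)⟩

/-- The underlying vector space of `B^ψ`. -/
def bergmanOrliczSubmodule (ψ : OrliczFunction) : Submodule ℂ (ℂ → ℂ) where
  carrier := {f | f ∈ holomorphicDisc ∧ bergmanOrliczENorm ψ f < ⊤}
  add_mem' := fun hf hg => ⟨add_mem hf.1 hg.1,
    (ψ.luxemburg_add_le _ (holomorphicDisc.aemeasurable hf.1)).trans_lt
      (ENNReal.add_lt_top.2 ⟨hf.2, hg.2⟩)⟩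
  zero_mem' := ⟨zero_mem _, (ψ.luxemburg_zero _).trans_lt ENNReal.zero_lt_top⟩
  smul_mem' := fun c _ hf => ⟨Submodule.smul_mem _ c hf.1,
    (ψ.luxemburg_smul_le _ c _).trans_lt (ENNReal.mul_lt_top ENNReal.coe_lt_top hf.2)⟩

/-- The Hardy-Orlicz space `H^ψ`. It is a new type, so that its only topology is the one of its
norm (and not the topology of pointwise convergence). -/
def HardyOrlicz (ψ : OrliczFunction) : Type := hardyOrliczSubmodule ψ

/-- The Bergman-Orlicz space `B^ψ`; again a new type. -/
def BergmanOrlicz (ψ : OrliczFunction) : Type := bergmanOrliczSubmodule ψ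

theorem normedSpaceCore_of_enorm {V : Type*} [AddCommGroup V] [Module ℂ V] [Norm V]
    (e : V → ℝ≥0∞) (hn : ∀ f, ‖f‖ = (e f).toReal) (hfin : ∀ f, e f < ⊤) (h0 : e 0 = 0)
    (hadd : ∀ f g, e (f + g) ≤ e f + e g) (hsmul : ∀ (c : ℂ) (f : V), e (c • f) ≤ (‖c‖₊ : ℝ≥0∞) * e f)
    (hz : ∀ f, e f = 0 → f = 0) : NormedSpace.Core ℂ V := by
  have hle : ∀ (c : ℂ) (f : V), ‖c • f‖ ≤ ‖c‖ * ‖f‖ := by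
    intro c f
    rw [hn, hn]
    have := ENNReal.toReal_mono (ENNReal.mul_lt_top ENNReal.coe_lt_top (hfin f)).ne (hsmul c f)
    simpa [ENNReal.toReal_mul] using this
  refine { norm_nonneg := ?_, norm_smul := ?_, norm_triangle := ?_, norm_eq_zero_iff := ?_ }
  · intro f; rw [hn]; exact ENNReal.toReal_nonneg
  · intro c f
    refine le_antisymm (hle c f) ?_
    rcases eq_or_ne c 0 with rfl | hc
    · simp [hn, h0]
    · have h1 := hle c⁻¹ (c • f)
      rw [inv_smul_smul₀ hc, norm_inv] at h1
      have hc' : 0 < ‖c‖ := norm_pos_iff.2 hc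
      calc ‖c‖ * ‖f‖ ≤ ‖c‖ * (‖c‖⁻¹ * ‖c • f‖) := by gcongr
        _ = ‖c • f‖ := by field_simp
  · intro f g
    rw [hn, hn, hn, ← ENNReal.toReal_add (hfin f).ne (hfin g).ne]
    exact ENNReal.toReal_mono (ENNReal.add_lt_top.2 ⟨hfin f, hfin g⟩).ne (hadd f g)
  · intro f
    rw [hn, ENNReal.toReal_eq_zero_iff]
    constructor
    · rintro (h | h)
      · exact hz f h
      · exact absurd h (hfin f).ne
    · rintro rfl; exact Or.inl h0

namespace HardyOrlicz

variable (ψ : OrliczFunction)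

instance : AddCommGroup (HardyOrlicz ψ) := inferInstanceAs (AddCommGroup (hardyOrliczSubmodule ψ))

instance : Module ℂ (HardyOrlicz ψ) := inferInstanceAs (Module ℂ (hardyOrliczSubmodule ψ))

instance : Norm (HardyOrlicz ψ) := ⟨fun f => (hardyOrliczENorm ψ f.1).toReal⟩

theorem core : NormedSpace.Core ℂ (HardyOrlicz ψ) :=
  normedSpaceCore_of_enorm (V := HardyOrlicz ψ) (fun f => hardyOrliczENorm ψ f.1) (fun _ => rfl) (fun f => f.2.2)
    (hardyOrliczENorm_zero ψ) (fun f _ => hardyOrliczENorm_add_le ψ f.2.1)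
    (fun c f => hardyOrliczENorm_smul_le ψ c f.1)
    (fun f h => Subtype.ext (hardyOrliczENorm_eq_zero ψ f.2.1 h))

instance : NormedAddCommGroup (HardyOrlicz ψ) := NormedAddCommGroup.ofCore (core ψ)

instance : NormedSpace ℂ (HardyOrlicz ψ) := NormedSpace.ofCore (core ψ)

end HardyOrlicz

namespace BergmanOrlicz

variable (ψ : OrliczFunction)

instance : AddCommGroup (BergmanOrlicz ψ) :=
  inferInstanceAs (AddCommGroup (bergmanOrliczSubmodule ψ))

instance : Module ℂ (BergmanOrlicz ψ) := inferInstanceAs (Module ℂ (bergmanOrliczSubmodule ψ))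

instance : Norm (BergmanOrlicz ψ) := ⟨fun f => (bergmanOrliczENorm ψ f.1).toReal⟩

theorem core : NormedSpace.Core ℂ (BergmanOrlicz ψ) :=
  normedSpaceCore_of_enorm (V := BergmanOrlicz ψ) (fun f => bergmanOrliczENorm ψ f.1) (fun _ => rfl) (fun f => f.2.2)
    (ψ.luxemburg_zero _)
    (fun f _ => ψ.luxemburg_add_le _ (holomorphicDisc.aemeasurable f.2.1))
    (fun c f => ψ.luxemburg_smul_le discMeasure c f.1)
    (fun f h => Subtype.ext (bergmanOrliczENorm_eq_zero ψ f.2.1 h))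

instance : NormedAddCommGroup (BergmanOrlicz ψ) := NormedAddCommGroup.ofCore (core ψ)

instance : NormedSpace ℂ (BergmanOrlicz ψ) := NormedSpace.ofCore (core ψ)

end BergmanOrlicz

/-- A complex normed space is reflexive when the canonical embedding into its bidual is onto. -/
def IsReflexiveSpace (E : Type*) [NormedAddCommGroup E] [NormedSpace ℂ E] : Prop :=
  Function.Surjective (NormedSpace.inclusionInDoubleDual ℂ E)

end

/-- In a reflexive space a bounded sequence converges weakly along every ultrafilter; here along
a fixed nonprincipal one. -/
theorem IsReflexiveSpace.exists_tendsto_dual {E : Type*} [NormedAddCommGroup E] [NormedSpace ℂ E]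
    (h : IsReflexiveSpace E) {x : ℕ → E} {R : ℝ} (hx : ∀ n, ‖x n‖ ≤ R) :
    ∃ y : E, ∀ f : StrongDual ℂ E,
      Tendsto (fun n => f (x n)) (hyperfilter ℕ : Filter ℕ) (𝓝 (f y)) := by
  have hb : ∀ (f : StrongDual ℂ E) n, ‖f (x n)‖ ≤ R * ‖f‖ := fun f n => by
    rw [mul_comm]
    exact (f.le_opNorm _).trans (mul_le_mul_of_nonneg_left (hx n) (norm_nonneg f))
  have hlim : ∀ f : StrongDual ℂ E, ∃ a : ℂ, ‖a‖ ≤ R * ‖f‖ ∧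
      Tendsto (fun n => f (x n)) (hyperfilter ℕ : Filter ℕ) (𝓝 a) := by
    intro f
    obtain ⟨a, ha, hlim⟩ := (isCompact_closedBall (0 : ℂ) (R * ‖f‖)).ultrafilter_le_nhds
      ((hyperfilter ℕ).map fun n => f (x n)) (by
        rw [Ultrafilter.coe_map, le_principal_iff, mem_map]
        exact univ_mem' fun n => by simpa using hb f n)
    exact ⟨a, by simpa using ha, hlim⟩
  choose L hLn hL using hlim
  let Φ : StrongDual ℂ (StrongDual ℂ E) := LinearMap.mkContinuous
    { toFun := L
      map_add' := fun f g => tendsto_nhds_unique (hL (f + g)) ((hL f).add (hL g))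
      map_smul' := fun c f => tendsto_nhds_unique (hL (c • f)) ((hL f).const_smul c) } R hLn
  obtain ⟨y, hy⟩ := h Φ
  refine ⟨y, fun f => ?_⟩
  have h1 : f y = L f := by
    rw [← NormedSpace.dual_def ℂ E y f, hy]
    rfl
  rw [h1]
  exact hL f

theorem Submodule.exists_dual_eq_zero_of_notMem {E : Type*} [NormedAddCommGroup E]
    [NormedSpace ℂ E] {M : Submodule ℂ E} (hM : IsClosed (M : Set E)) {y : E} (hy : y ∉ M) :
    ∃ f : StrongDual ℂ E, (∀ x ∈ M, f x = 0) ∧ f y ≠ 0 := by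
  obtain ⟨f, u, hu, hfy⟩ := RCLike.geometric_hahn_banach_closed_point (𝕜 := ℂ)
    (M.restrictScalars ℝ).convex hM hy
  have h0 : 0 < u := by simpa using hu 0 M.zero_mem
  have hz : ∀ x ∈ M, f x = 0 := by
    intro x hx
    by_contra hne
    have h1 := hu (((u : ℂ) / f x) • x) (M.smul_mem _ hx)
    rw [map_smul, smul_eq_mul, div_mul_cancel₀ _ hne] at h1
    simp at h1
  refine ⟨f, hz, fun h => ?_⟩
  rw [h] at hfy
  simp at hfy
  linarith

/-- A weak limit of a sequence in a subspace lies in its norm closure. -/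
theorem Submodule.mem_topologicalClosure_of_tendsto_dual {E ι : Type*} [NormedAddCommGroup E]
    [NormedSpace ℂ E] {M : Submodule ℂ E} {l : Filter ι} [l.NeBot] {x : ι → E}
    (hx : ∀ n, x n ∈ M) {y : E}
    (hy : ∀ f : StrongDual ℂ E, Tendsto (fun n => f (x n)) l (𝓝 (f y))) :
    y ∈ M.topologicalClosure := by
  by_contra hne
  obtain ⟨f, hf, hfy⟩ := Submodule.exists_dual_eq_zero_of_notMem
    M.isClosed_topologicalClosure hne
  refine hfy (tendsto_nhds_unique (hy f) ?_)
  simp only [hf _ (M.le_topologicalClosure (hx _))]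
  exact tendsto_const_nhds

namespace OrliczFunction

variable (ψ : OrliczFunction)

theorem map_mul_le {c : ℝ≥0} (hc : c ≤ 1) (x : ℝ≥0) : ψ (c * x) ≤ c * ψ x := by
  have h := ψ.convexOn_toFun.2 (mem_univ x) (mem_univ 0) (zero_le) (zero_le)
    (add_tsub_cancel_of_le hc)
  simpa [ψ.map_zero] using h

/-- The chord inequality `ψ y ≥ (y / a - 1) ψ a`. -/
theorem mul_map_le (a y : ℝ≥0) : y * ψ a ≤ a * (ψ y + ψ a) := by
  rcases eq_or_ne a 0 with rfl | ha
  · simp [ψ.map_zero]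
  rcases le_total y a with h | h
  · exact mul_le_mul' h le_add_self
  · have hy : 0 < y := lt_of_lt_of_le (pos_iff_ne_zero.2 ha) h
    have h1 := ψ.map_mul_le (c := a / y) ((div_le_one hy).2 h) y
    rw [div_mul_cancel₀ _ hy.ne', div_mul_eq_mul_div, le_div_iff₀ hy, mul_comm] at h1
    exact h1.trans (mul_le_mul' le_rfl le_self_add)

theorem exists_le_mul_add_one : ∃ x₀ : ℝ≥0, ∀ y, y ≤ x₀ * (ψ y + 1) := by
  obtain ⟨x, hx⟩ := (ψ.tendsto_atTop.eventually_ge_atTop 1).exists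
  refine ⟨x, fun y => ?_⟩
  rcases le_total y x with h | h
  · exact h.trans (le_mul_of_one_le_right (zero_le) le_add_self)
  rcases eq_or_ne y 0 with rfl | hy
  · exact zero_le
  have hy : 0 < y := pos_iff_ne_zero.2 hy
  have h1 := ψ.map_mul_le (c := x / y) ((div_le_one hy).2 h) y
  rw [div_mul_cancel₀ _ hy.ne', div_mul_eq_mul_div, le_div_iff₀ hy] at h1
  calc y ≤ ψ x * y := le_mul_of_one_le_left (zero_le) hx
    _ ≤ x * ψ y := h1
    _ ≤ _ := mul_le_mul' le_rfl le_self_add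

theorem map_add_half_le (a b : ℝ≥0) : ψ ((a + b) / 2) ≤ ψ a + ψ b := by
  refine (ψ.monotone_toFun (?_ : _ ≤ max a b)).trans ?_
  · rw [div_le_iff₀ two_pos, mul_two]
    exact add_le_add (le_max_left _ _) (le_max_right _ _)
  · rw [ψ.monotone_toFun.map_max]
    exact max_le_add_of_nonneg (zero_le) (zero_le)

theorem modular_anti {Ω : Type*} [MeasurableSpace Ω] (μ : Measure Ω) (f : Ω → ℂ) {K L : ℝ≥0}
    (hK : 0 < K) (hKL : K ≤ L) : ψ.modular μ f L ≤ ψ.modular μ f K := by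
  refine lintegral_mono fun ω => ENNReal.coe_le_coe.2 (ψ.monotone_toFun ?_)
  gcongr

theorem modular_le_one_of_luxemburg_lt {Ω : Type*} [MeasurableSpace Ω] (μ : Measure Ω)
    {f : Ω → ℂ} {c : ℝ≥0} (h : ψ.luxemburg μ f < c) : ψ.modular μ f c ≤ 1 := by
  obtain ⟨K, hK, h1, h2⟩ := ψ.exists_of_luxemburg_lt μ h
  exact (ψ.modular_anti μ f hK (by exact_mod_cast h2.le)).trans h1

theorem exists_lintegral_enorm_le : ∃ x₀ : ℝ≥0, ∀ {Ω : Type} [MeasurableSpace Ω] (μ : Measure Ω)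
    [IsProbabilityMeasure μ] (f : Ω → ℂ) (c : ℝ≥0), 0 < c → AEMeasurable f μ →
    ψ.modular μ f c ≤ 1 → ∫⁻ ω, ‖f ω‖ₑ ∂μ ≤ (x₀ * c : ℝ≥0) := by
  obtain ⟨x₀, h₀⟩ := ψ.exists_le_mul_add_one
  refine ⟨x₀ * 2, fun {Ω} _ μ _ f c hc hf h => ?_⟩
  have hpt : ∀ ω, ‖f ω‖ₑ ≤ ((x₀ * c : ℝ≥0) : ℝ≥0∞) * ((ψ (‖f ω‖₊ / c) : ℝ≥0∞) + 1) := by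
    intro ω
    have h1 := h₀ (‖f ω‖₊ / c)
    rw [div_le_iff₀ hc] at h1
    rw [enorm_eq_nnnorm]
    norm_cast
    rw [mul_right_comm]
    exact h1
  calc ∫⁻ ω, ‖f ω‖ₑ ∂μ
      ≤ ∫⁻ ω, ((x₀ * c : ℝ≥0) : ℝ≥0∞) * ((ψ (‖f ω‖₊ / c) : ℝ≥0∞) + 1) ∂μ := lintegral_mono hpt
    _ = ((x₀ * c : ℝ≥0) : ℝ≥0∞) * (ψ.modular μ f c + 1) := by
      rw [lintegral_const_mul' _ _ ENNReal.coe_ne_top, lintegral_add_right _ measurable_const]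
      simp [modular]
    _ ≤ ((x₀ * c : ℝ≥0) : ℝ≥0∞) * (1 + 1) := by gcongr
    _ = _ := by push_cast; ring

theorem exists_lacunary_of_not_deltaTwo {ψ : OrliczFunction} (hψ : ¬ ψ.DeltaTwo) :
    ∃ x : ℕ → ℝ≥0, (∀ n, 0 < x n) ∧ (∀ n, 2 * x n ≤ x (n + 1)) ∧ (∀ n, 1 ≤ ψ (x n)) ∧
      ∀ n, 4 ^ n * ψ (x n) ≤ ψ (2 * x n) := by
  obtain ⟨x₁, hx₁⟩ := (ψ.tendsto_atTop.eventually_ge_atTop 1).exists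
  have h : ∀ C x₀ : ℝ≥0, ∃ x, x₀ ≤ x ∧ C * ψ x ≤ ψ (2 * x) := by
    simp only [DeltaTwo] at hψ
    push Not at hψ
    intro C x₀
    obtain ⟨x, h1, h2⟩ := hψ C x₀
    exact ⟨x, h1, h2.le⟩
  choose X hX hX' using h
  let x : ℕ → ℝ≥0 := fun n =>
    Nat.rec (X 1 (x₁ + 1)) (fun n y => X (4 ^ (n + 1)) (2 * y)) n
  have h2 : ∀ n, 2 * x n ≤ x (n + 1) := fun n => hX _ _
  have hge : ∀ n, x₁ + 1 ≤ x n := by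
    intro n
    induction n with
    | zero => exact hX _ _
    | succ n ih => exact (ih.trans (le_mul_of_one_le_left (zero_le) one_le_two)).trans (h2 n)
  refine ⟨x, fun n => lt_of_lt_of_le (by positivity) (hge n), h2,
    fun n => hx₁.trans (ψ.monotone_toFun (le_self_add.trans (hge n))), fun n => ?_⟩
  cases n with
  | zero =>
    rw [pow_zero]
    exact hX' 1 (x₁ + 1)
  | succ n => exact hX' _ _

end OrliczFunction

/-- For a lacunary sequence `x`, `∑ x k * γ k ^ 2` is comparable to `sup x k * γ k`. -/
theorem sum_mul_sq_le_of_lacunary {x γ : ℕ → ℝ} {M : ℝ} (hx : ∀ k, 0 < x k)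
    (hx2 : ∀ k, 2 * x k ≤ x (k + 1)) (hγ0 : ∀ k, 0 ≤ γ k) (hγ1 : ∀ k, γ k ≤ 1) (hM : 0 ≤ M)
    (N : ℕ) (h : ∀ k < N, x k * γ k ≤ M) :
    ∑ k ∈ Finset.range N, x k * γ k ^ 2 ≤ 4 * M := by
  have key : ∀ n ≤ N, ∑ k ∈ Finset.range n, x k * γ k ^ 2 ≤ x n ∧
      (M ≤ x n → ∑ k ∈ Finset.range n, x k * γ k ^ 2 ≤ 4 * M - 2 * (M ^ 2 / x n)) := by
    intro n
    induction n with
    | zero =>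
      intro _
      refine ⟨by simpa using (hx 0).le, fun hM0 => ?_⟩
      have : M ^ 2 / x 0 ≤ M := by
        rw [div_le_iff₀ (hx 0)]; nlinarith
      simp only [Finset.range_zero, Finset.sum_empty]
      linarith
    | succ n ih =>
      intro hn
      obtain ⟨h1, h2⟩ := ih (by omega)
      have hxn := hx n
      have hxn1 := hx (n + 1)
      have hdouble := hx2 n
      have hsq : γ n ^ 2 ≤ 1 := pow_le_one₀ (hγ0 n) (hγ1 n)
      have hle : x n * γ n ^ 2 ≤ x n := mul_le_of_le_one_right hxn.le hsq
      rw [Finset.sum_range_succ]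
      refine ⟨by linarith, fun hM1 => ?_⟩
      rcases le_total M (x n) with hMn | hMn
      · have h3 := h2 hMn
        have h4 : x n * γ n ^ 2 ≤ M ^ 2 / x n := by
          rw [le_div_iff₀ hxn]
          have := pow_le_pow_left₀ (mul_nonneg hxn.le (hγ0 n)) (h n (by omega)) 2
          nlinarith
        have h5 : 2 * (M ^ 2 / x (n + 1)) ≤ M ^ 2 / x n := by
          rw [← mul_div_assoc, div_le_div_iff₀ hxn1 hxn]
          nlinarith [sq_nonneg M]
        linarith
      · have : M ^ 2 / x (n + 1) ≤ M := by
          rw [div_le_iff₀ hxn1]; nlinarith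
        linarith
  obtain ⟨h1, h2⟩ := key N le_rfl
  rcases le_total M (x N) with hMN | hMN
  · have := h2 hMN
    have : 0 ≤ M ^ 2 / x N := div_nonneg (sq_nonneg M) (hx N).le
    linarith
  · linarith

/-- Squaring preserves thin sectors around the positive real axis, roughly doubling their
opening. -/
theorem Complex.sector_sq {u : ℂ} {κ : ℝ} (hκ0 : 0 ≤ κ) (hκ : κ ≤ 1 / 5) (h0 : 0 ≤ u.re)
    (h : |u.im| ≤ κ * u.re) :
    (24 / 25) * u.re ^ 2 ≤ (u ^ 2).re ∧ |(u ^ 2).im| ≤ (25 / 12 * κ) * (u ^ 2).re := by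
  have h1 : u.im ^ 2 ≤ (κ * u.re) ^ 2 := by
    rw [← sq_abs u.im]; exact pow_le_pow_left₀ (abs_nonneg _) h 2
  have hre : (u ^ 2).re = u.re ^ 2 - u.im ^ 2 := by simp [sq]
  have him : (u ^ 2).im = 2 * (u.re * u.im) := by simp [sq]; ring
  have hA : (24 / 25) * u.re ^ 2 ≤ (u ^ 2).re := by
    have h2 : κ ^ 2 ≤ (1 / 5) ^ 2 := pow_le_pow_left₀ hκ0 hκ 2
    rw [hre]
    nlinarith [mul_le_mul_of_nonneg_right h2 (sq_nonneg u.re)]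
  refine ⟨hA, ?_⟩
  rw [him, abs_mul, abs_mul, abs_two, abs_of_nonneg h0]
  have h3 : u.re * |u.im| ≤ u.re * (κ * u.re) := mul_le_mul_of_nonneg_left h h0
  nlinarith [mul_le_mul_of_nonneg_left hA hκ0]

theorem Complex.half_re_pow_eight_le {u : ℂ} (h0 : 0 ≤ u.re) (h : |u.im| ≤ 1 / 25 * u.re) :
    1 / 2 * u.re ^ 8 ≤ (u ^ 8).re := by
  obtain ⟨h2, h2'⟩ := Complex.sector_sq (by norm_num) (by norm_num) h0 h
  have h20 : 0 ≤ (u ^ 2).re := le_trans (by positivity) h2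
  obtain ⟨h4, h4'⟩ := Complex.sector_sq (by norm_num) (by norm_num) h20 h2'
  have h40 : 0 ≤ ((u ^ 2) ^ 2).re := le_trans (by positivity) h4
  obtain ⟨h8, -⟩ := Complex.sector_sq (by norm_num) (by norm_num) h40 h4'
  have e : u ^ 8 = ((u ^ 2) ^ 2) ^ 2 := by ring
  rw [e]
  calc 1 / 2 * u.re ^ 8
      ≤ 24 / 25 * (24 / 25 * (24 / 25 * u.re ^ 2) ^ 2) ^ 2 := by
        have : 0 ≤ u.re ^ 8 := by positivity
        ring_nf
        linarith
    _ ≤ 24 / 25 * (24 / 25 * (u ^ 2).re ^ 2) ^ 2 := by gcongr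
    _ ≤ 24 / 25 * ((u ^ 2) ^ 2).re ^ 2 := by gcongr
    _ ≤ _ := h8

/-- The function `δ / (1 + δ - z)`, which peaks at the boundary point `1`. -/
noncomputable def peak (δ : ℝ) (z : ℂ) : ℂ := δ / (1 + δ - z)

theorem re_one_add_sub (δ : ℝ) (z : ℂ) : (1 + δ - z : ℂ).re = δ + (1 - z.re) := by
  simp; ring

theorem one_add_sub_ne_zero {δ : ℝ} (hδ : 0 < δ) {z : ℂ} (hz : z.re ≤ 1) :
    (1 + δ - z : ℂ) ≠ 0 := by
  intro h
  have := re_one_add_sub δ z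
  rw [h, Complex.zero_re] at this
  linarith

theorem norm_peak_le_one {δ : ℝ} (hδ : 0 < δ) {z : ℂ} (hz : z.re ≤ 1) : ‖peak δ z‖ ≤ 1 := by
  rw [peak, norm_div, Complex.norm_real, Real.norm_of_nonneg hδ.le]
  refine div_le_one_of_le₀ ?_ (norm_nonneg _)
  have h := Complex.re_le_norm (1 + δ - z)
  rw [re_one_add_sub] at h
  linarith

theorem differentiableOn_peak {δ : ℝ} (hδ : 0 < δ) :
    DifferentiableOn ℂ (peak δ) {z | z.re ≤ 1} :=
  (differentiableOn_const _).div ((differentiableOn_const _).sub differentiableOn_id)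
    fun _ hz => one_add_sub_ne_zero hδ hz

theorem peak_re (δ : ℝ) (z : ℂ) :
    (peak δ z).re = δ * (δ + (1 - z.re)) / Complex.normSq (1 + δ - z) := by
  rw [peak, Complex.div_re, re_one_add_sub]
  simp

theorem peak_im (δ : ℝ) (z : ℂ) :
    (peak δ z).im = δ * z.im / Complex.normSq (1 + δ - z) := by
  rw [peak, Complex.div_im]
  simp [neg_div]

theorem peak_sector {δ : ℝ} (hδ : 0 < δ) {z : ℂ} (hz : z.re ≤ 1)
    (h : |z.im| ≤ 1 / 25 * (1 - z.re)) :
    0 ≤ (peak δ z).re ∧ |(peak δ z).im| ≤ 1 / 25 * (peak δ z).re := by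
  have hn := Complex.normSq_nonneg (1 + δ - z)
  rw [peak_re, peak_im, abs_div, abs_of_nonneg hn, abs_mul, abs_of_pos hδ, ← mul_div_assoc]
  refine ⟨div_nonneg (mul_nonneg hδ.le (by linarith)) hn, ?_⟩
  refine div_le_div_of_nonneg_right ?_ hn
  nlinarith [mul_le_mul_of_nonneg_left h hδ.le]

theorem third_le_peak_re {δ : ℝ} (hδ : 0 < δ) {z : ℂ} (hz : z.re ≤ 1)
    (h : |z.im| ≤ 1 / 25 * (1 - z.re)) (hzδ : 1 - z.re ≤ δ) : 1 / 3 ≤ (peak δ z).re := by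
  have hn : 0 < Complex.normSq (1 + δ - z) :=
    Complex.normSq_pos.2 (one_add_sub_ne_zero hδ hz)
  rw [peak_re, le_div_iff₀ hn, Complex.normSq_apply, re_one_add_sub]
  have hi : (1 + δ - z : ℂ).im = - z.im := by simp
  have h1 : z.im * z.im ≤ (1 / 25 * (1 - z.re)) ^ 2 := by
    rw [← pow_two, ← sq_abs]; exact pow_le_pow_left₀ (abs_nonneg _) h 2
  rw [hi]
  nlinarith [mul_nonneg hδ.le (sub_nonneg.2 hz)]

theorem peak_pow_eight_re_nonneg {δ : ℝ} (hδ : 0 < δ) {z : ℂ} (hz : z.re ≤ 1)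
    (h : |z.im| ≤ 1 / 25 * (1 - z.re)) : 0 ≤ (peak δ z ^ 8).re := by
  obtain ⟨h1, h2⟩ := peak_sector hδ hz h
  exact le_trans (by positivity) (Complex.half_re_pow_eight_le h1 h2)

theorem le_peak_pow_eight_re {δ : ℝ} (hδ : 0 < δ) {z : ℂ} (hz : z.re ≤ 1)
    (h : |z.im| ≤ 1 / 25 * (1 - z.re)) (hzδ : 1 - z.re ≤ δ) :
    1 / 2 * (1 / 3) ^ 8 ≤ (peak δ z ^ 8).re := by
  obtain ⟨h1, h2⟩ := peak_sector hδ hz h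
  have h3 := third_le_peak_re hδ hz h hzδ
  refine le_trans ?_ (Complex.half_re_pow_eight_le h1 h2)
  gcongr

namespace OrliczFunction

theorem map_finset_sup_le_sum (ψ : OrliczFunction) {α : Type*} (s : Finset α) (f : α → ℝ≥0) :
    ψ (s.sup f) ≤ ∑ k ∈ s, ψ (f k) := by
  classical
  induction s using Finset.induction_on with
  | empty => simp [ψ.map_zero]
  | insert a s ha ih =>
    rw [Finset.sup_insert, Finset.sum_insert ha, ψ.monotone_toFun.map_sup]
    exact sup_le (le_self_add) (ih.trans le_add_self)

end OrliczFunction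

/-- The partial sums of `∑ x k * peak (δ k) ^ 8`, extended by zero outside the disc. -/
noncomputable def peakSum (x δ : ℕ → ℝ≥0) (N : ℕ) : ℂ → ℂ :=
  (Metric.ball 0 1).indicator fun z => ∑ k ∈ Finset.range N, (x k : ℂ) * peak (δ k) z ^ 8

theorem re_le_one_of_mem_ball {z : ℂ} (hz : z ∈ Metric.ball (0 : ℂ) 1) : z.re ≤ 1 :=
  (Complex.re_le_norm z).trans (by simpa using (mem_ball_zero_iff.1 hz).le)

theorem peakSum_apply {x δ : ℕ → ℝ≥0} {N : ℕ} {z : ℂ} (hz : z ∈ Metric.ball (0 : ℂ) 1) :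
    peakSum x δ N z = ∑ k ∈ Finset.range N, (x k : ℂ) * peak (δ k) z ^ 8 :=
  indicator_of_mem hz _

theorem peakSum_mem_holomorphicDisc {x δ : ℕ → ℝ≥0} (hδ : ∀ k, 0 < δ k) (N : ℕ) :
    peakSum x δ N ∈ holomorphicDisc := by
  refine ⟨DifferentiableOn.congr ?_ fun z hz => peakSum_apply hz, fun z hz =>
    indicator_of_notMem hz _⟩
  exact DifferentiableOn.fun_sum fun k _ => ((differentiableOn_peak (NNReal.coe_pos.2 (hδ k))).mono
    fun z hz => re_le_one_of_mem_ball hz).pow 8 |>.const_mul _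

theorem norm_peakSum_le {x δ : ℕ → ℝ≥0} (N : ℕ) {z : ℂ}
    (hz : z ∈ Metric.ball (0 : ℂ) 1) :
    ‖peakSum x δ N z‖ ≤ ∑ k ∈ Finset.range N, x k * (‖peak (δ k) z‖ ^ 4) ^ 2 := by
  rw [peakSum_apply hz]
  refine (norm_sum_le _ _).trans (Finset.sum_le_sum fun k _ => le_of_eq ?_)
  rw [norm_mul, norm_pow, ← pow_mul]
  simp

theorem norm_peakSum_le_sum {x δ : ℕ → ℝ≥0} (hδ : ∀ k, 0 < δ k) (N : ℕ) {z : ℂ}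
    (hz : z ∈ Metric.ball (0 : ℂ) 1) :
    ‖peakSum x δ N z‖ ≤ ∑ k ∈ Finset.range N, (x k : ℝ) := by
  refine (norm_peakSum_le N hz).trans (Finset.sum_le_sum fun k _ => ?_)
  rw [← pow_mul]
  exact mul_le_of_le_one_right (x k).2
    (pow_le_one₀ (norm_nonneg _) (norm_peak_le_one (hδ k) (re_le_one_of_mem_ball hz)))

theorem le_re_peakSum {x δ : ℕ → ℝ≥0} (hδ : ∀ k, 0 < δ k) {n N : ℕ} (hn : n < N) {z : ℂ}
    (hz : z ∈ Metric.ball (0 : ℂ) 1) (h : |z.im| ≤ 1 / 25 * (1 - z.re))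
    (hzδ : 1 - z.re ≤ δ n) :
    1 / 2 * (1 / 3) ^ 8 * (x n : ℝ) ≤ (peakSum x δ N z).re := by
  have hz1 := re_le_one_of_mem_ball hz
  rw [peakSum_apply hz, Complex.re_sum]
  have hre : ∀ k, ((x k : ℂ) * peak (δ k) z ^ 8).re = x k * (peak (δ k) z ^ 8).re := fun k =>
    Complex.re_ofReal_mul _ _
  refine le_trans ?_ (Finset.single_le_sum (f := fun k => ((x k : ℂ) * peak (δ k) z ^ 8).re)
    (fun k _ => ?_) (Finset.mem_range.2 hn))
  · simp only [hre]
    rw [mul_comm]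
    exact mul_le_mul_of_nonneg_left (le_peak_pow_eight_re (hδ n) hz1 h hzδ) (x n).2
  · simp only [hre]
    exact mul_nonneg (x k).2 (peak_pow_eight_re_nonneg (hδ k) hz1 h)

namespace OrliczFunction

variable (ψ : OrliczFunction)

theorem map_peakSum_le {x δ : ℕ → ℝ≥0} (hx : ∀ k, 0 < x k) (hx2 : ∀ k, 2 * x k ≤ x (k + 1))
    (hδ : ∀ k, 0 < δ k) (N : ℕ) {z : ℂ} (hz : z ∈ Metric.ball (0 : ℂ) 1) :
    ψ (‖peakSum x δ N z‖₊ / 4) ≤ ∑ k ∈ Finset.range N, ψ (x k) * ‖peak (δ k) z‖₊ ^ 4 := by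
  have hp : ∀ k, ‖peak (δ k) z‖₊ ^ 4 ≤ 1 := fun k =>
    pow_le_one₀ (zero_le) (norm_peak_le_one (hδ k) (re_le_one_of_mem_ball hz))
  set M : ℝ≥0 := (Finset.range N).sup fun k => x k * ‖peak (δ k) z‖₊ ^ 4 with hM
  have h1 : ‖peakSum x δ N z‖₊ / 4 ≤ M := by
    rw [div_le_iff₀ (by norm_num), mul_comm]
    refine (norm_peakSum_le N hz).trans (sum_mul_sq_le_of_lacunary (M := M)
      (x := fun k => x k) (γ := fun k => ‖peak (δ k) z‖ ^ 4)
      hx (fun k => by exact_mod_cast hx2 k) (fun k => by positivity) (fun k => hp k) M.2 N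
      fun k hk => ?_)
    exact Finset.le_sup (f := fun k => x k * ‖peak (δ k) z‖₊ ^ 4) (Finset.mem_range.2 hk)
  refine (ψ.monotone_toFun h1).trans ((ψ.map_finset_sup_le_sum _ _).trans
    (Finset.sum_le_sum fun k _ => ?_))
  rw [mul_comm, mul_comm (ψ (x k))]
  exact ψ.map_mul_le (hp k) _

theorem exists_scales {x : ℕ → ℝ≥0} (hx : ∀ n, 1 ≤ ψ (x n)) {d : ℕ} (hd : d ≠ 0) :
    ∃ δ : ℕ → ℝ≥0, (∀ k, 0 < δ k) ∧ (∀ k, δ k ≤ 1) ∧ ∀ k, ψ (x k) * δ k ^ d = 2⁻¹ ^ k := by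
  have hψ : ∀ k, 0 < ψ (x k) := fun k => lt_of_lt_of_le one_pos (hx k)
  refine ⟨fun k => (2⁻¹ ^ k / ψ (x k)) ^ ((d : ℝ)⁻¹), fun k => ?_, fun k => ?_, fun k => ?_⟩
  · exact NNReal.rpow_pos (div_pos (by positivity) (hψ k))
  · refine NNReal.rpow_le_one ?_ (by positivity)
    exact div_le_one_of_le₀ ((pow_le_one₀ (by positivity) (by norm_num)).trans (hx k)) (zero_le)
  · rw [NNReal.rpow_inv_natCast_pow _ hd, mul_div_cancel₀ _ (hψ k).ne']

theorem modular_peakSum_le_one {Ω : Type*} [MeasurableSpace Ω] (μ : Measure Ω) {φ : Ω → ℂ}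
    (hφm : Measurable φ) (hφ : ∀ᵐ ω ∂μ, φ ω ∈ Metric.ball (0 : ℂ) 1) {x δ : ℕ → ℝ≥0}
    (hx : ∀ k, 0 < x k) (hx2 : ∀ k, 2 * x k ≤ x (k + 1)) (hδ : ∀ k, 0 < δ k) {C : ℝ≥0} {d : ℕ}
    (hδd : ∀ k, ψ (x k) * δ k ^ d = 2⁻¹ ^ k)
    (hC : ∀ k, ∫⁻ ω, ‖peak (δ k) (φ ω)‖ₑ ^ 4 ∂μ ≤ C * (δ k : ℝ≥0∞) ^ d) (N : ℕ) :
    ψ.modular μ (fun ω => peakSum x δ N (φ ω)) (4 * (2 * C + 1)) ≤ 1 := by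
  have hL : 0 < 2 * C + 1 := by positivity
  have hpm : ∀ k, Measurable (peak (δ k)) := fun k => by unfold peak; fun_prop
  have hpt : ∀ᵐ ω ∂μ, (ψ (‖peakSum x δ N (φ ω)‖₊ / (4 * (2 * C + 1))) : ℝ≥0∞) ≤
      ((2 * C + 1)⁻¹ : ℝ≥0) * ∑ k ∈ Finset.range N,
        (ψ (x k) : ℝ≥0∞) * ‖peak (δ k) (φ ω)‖ₑ ^ 4 := by
    filter_upwards [hφ] with ω hω
    have h1 := ψ.map_mul_le (inv_le_one_of_one_le₀ (le_add_self : 1 ≤ 2 * C + 1))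
      (‖peakSum x δ N (φ ω)‖₊ / 4)
    have h2 := ψ.map_peakSum_le hx hx2 hδ N hω
    have h3 : ‖peakSum x δ N (φ ω)‖₊ / (4 * (2 * C + 1)) =
        (2 * C + 1)⁻¹ * (‖peakSum x δ N (φ ω)‖₊ / 4) := by
      field_simp
    rw [h3]
    simp only [enorm_eq_nnnorm]
    exact_mod_cast h1.trans (mul_le_mul' le_rfl h2)
  calc ψ.modular μ (fun ω => peakSum x δ N (φ ω)) (4 * (2 * C + 1))
      ≤ ∫⁻ ω, ((2 * C + 1)⁻¹ : ℝ≥0) * ∑ k ∈ Finset.range N,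
        (ψ (x k) : ℝ≥0∞) * ‖peak (δ k) (φ ω)‖ₑ ^ 4 ∂μ := lintegral_mono_ae hpt
    _ = ((2 * C + 1)⁻¹ : ℝ≥0) * ∑ k ∈ Finset.range N,
        (ψ (x k) : ℝ≥0∞) * ∫⁻ ω, ‖peak (δ k) (φ ω)‖ₑ ^ 4 ∂μ := by
      have hm : ∀ k, Measurable fun ω => ‖peak (δ k) (φ ω)‖ₑ ^ 4 := fun k =>
        ((hpm k).comp hφm).enorm.pow_const 4
      rw [lintegral_const_mul' _ _ ENNReal.coe_ne_top,
        lintegral_finsetSum _ fun k _ => (hm k).const_mul _]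
      simp only [lintegral_const_mul' _ _ ENNReal.coe_ne_top]
    _ ≤ ((2 * C + 1)⁻¹ : ℝ≥0) * ∑ k ∈ Finset.range N,
        (ψ (x k) : ℝ≥0∞) * (C * (δ k : ℝ≥0∞) ^ d) := by gcongr with k; exact hC k
    _ = (((2 * C + 1)⁻¹ * (C * ∑ k ∈ Finset.range N, 2⁻¹ ^ k) : ℝ≥0) : ℝ≥0∞) := by
      simp only [← hδd, Finset.mul_sum]
      push_cast
      refine Finset.sum_congr rfl fun k _ => ?_
      ring
    _ ≤ 1 := by
      have hgeom : ∑ k ∈ Finset.range N, (2⁻¹ : ℝ≥0) ^ k ≤ 2 := by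
        have h := sum_geometric_two_le N
        rw [one_div] at h
        rw [← NNReal.coe_le_coe]
        push_cast
        exact h
      have h4 : (2 * C + 1)⁻¹ * (C * ∑ k ∈ Finset.range N, (2⁻¹ : ℝ≥0) ^ k) ≤ 1 := by
        rw [inv_mul_le_iff₀ hL, mul_one]
        calc C * ∑ k ∈ Finset.range N, (2⁻¹ : ℝ≥0) ^ k ≤ C * 2 := by gcongr
          _ = 2 * C := mul_comm _ _
          _ ≤ _ := le_self_add
      exact_mod_cast h4

end OrliczFunction

namespace OrliczFunction

variable {ψ : OrliczFunction} {E : Type*} [NormedAddCommGroup E] [NormedSpace ℂ E]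
  (T : E →ₗ[ℂ] (ℂ → ℂ)) {Ω : Type} [MeasurableSpace Ω] (μ : Measure Ω) [IsProbabilityMeasure μ]

theorem lintegral_enorm_le_of_modular {φ : Ω → ℂ}
    (hmeas : ∀ f, AEMeasurable (fun ω => T f (φ ω)) μ)
    (hmod : ∀ (f : E) (c : ℝ≥0), ‖f‖ < c → ψ.modular μ (fun ω => T f (φ ω)) c ≤ 1) :
    ∃ x₀ : ℝ≥0, ∀ f, ∫⁻ ω, ‖T f (φ ω)‖ₑ ∂μ ≤ x₀ * ‖f‖ₑ := by
  obtain ⟨x₀, h₀⟩ := ψ.exists_lintegral_enorm_le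
  refine ⟨x₀, fun f => ENNReal.le_of_forall_pos_le_add fun ε hε _ => ?_⟩
  have hx : 0 < x₀ + 1 := by positivity
  have hpos : 0 < ‖f‖₊ + ε / (x₀ + 1) := add_pos_of_nonneg_of_pos (zero_le) (by positivity)
  have h1 := h₀ μ (fun ω => T f (φ ω)) (‖f‖₊ + ε / (x₀ + 1)) hpos (hmeas f)
    (hmod f _ (by push_cast; exact lt_add_of_pos_right _ (by positivity)))
  refine h1.trans ?_
  rw [enorm_eq_nnnorm]
  norm_cast
  rw [mul_add]
  gcongr
  rw [← mul_div_assoc, div_le_iff₀ hx, mul_comm]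
  gcongr
  exact le_self_add

/-- Integration over a set is a bounded functional. -/
theorem exists_dual_eq_setIntegral {φ : Ω → ℂ}
    (hmeas : ∀ f, AEMeasurable (fun ω => T f (φ ω)) μ)
    (hmod : ∀ (f : E) (c : ℝ≥0), ‖f‖ < c → ψ.modular μ (fun ω => T f (φ ω)) c ≤ 1) (S : Set Ω) :
    (∀ f, Integrable (fun ω => T f (φ ω)) μ) ∧
      ∃ l : StrongDual ℂ E, ∀ f, l f = ∫ ω in S, T f (φ ω) ∂μ := by
  obtain ⟨x₀, h₀⟩ := lintegral_enorm_le_of_modular T μ hmeas hmod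
  have hint : ∀ f, Integrable (fun ω => T f (φ ω)) μ := fun f =>
    ⟨(hmeas f).aestronglyMeasurable, (h₀ f).trans_lt (ENNReal.mul_lt_top ENNReal.coe_lt_top
      enorm_lt_top)⟩
  refine ⟨hint, LinearMap.mkContinuous
    { toFun := fun f => ∫ ω in S, T f (φ ω) ∂μ
      map_add' := fun f g => by
        simp only [map_add, Pi.add_apply]
        exact integral_add (hint f).integrableOn (hint g).integrableOn
      map_smul' := fun c f => by
        simp only [map_smul, Pi.smul_apply, RingHom.id_apply]
        exact integral_smul _ _ } x₀ fun f => ?_, fun f => rfl⟩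
  have h1 : ‖∫ ω in S, T f (φ ω) ∂μ‖ₑ ≤ (x₀ : ℝ≥0∞) * ‖f‖ₑ :=
    (enorm_integral_le_lintegral_enorm _).trans ((setLIntegral_le_lintegral _ _).trans (h₀ f))
  rw [enorm_eq_nnnorm, enorm_eq_nnnorm] at h1
  have h2 : ‖∫ ω in S, T f (φ ω) ∂μ‖₊ ≤ x₀ * ‖f‖₊ := by exact_mod_cast h1
  exact h2

theorem exists_modular_le_of_mem_closure {ι : Type*} {φ : ι → Ω → ℂ}
    (hφ : ∀ i, ∀ᵐ ω ∂μ, φ i ω ∈ Metric.ball (0 : ℂ) 1)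
    (hmod : ∀ (f : E) (c : ℝ≥0), ‖f‖ < c → ∀ i, ψ.modular μ (fun ω => T f (φ i ω)) c ≤ 1)
    {y : E} (hy : y ∈ closure {f : E | ∃ G : ℝ, ∀ z ∈ Metric.ball (0 : ℂ) 1, ‖T f z‖ ≤ G})
    {ε : ℝ≥0} (hε : 0 < ε) :
    ∃ B : ℝ≥0, ∀ i, ψ.modular μ (fun ω => T y (φ i ω)) (2 * ε) ≤ B := by
  obtain ⟨g, ⟨G, hG⟩, hyg⟩ := Metric.mem_closure_iff.1 hy ε hε
  rw [dist_eq_norm] at hyg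
  refine ⟨1 + ψ (G.toNNReal / ε), fun i => ?_⟩
  have hpt : ∀ᵐ ω ∂μ, (ψ (‖T y (φ i ω)‖₊ / (2 * ε)) : ℝ≥0∞) ≤
      (ψ (‖T (y - g) (φ i ω)‖₊ / ε) : ℝ≥0∞) + ψ (G.toNNReal / ε) := by
    filter_upwards [hφ i] with ω hω
    have h1 : ‖T g (φ i ω)‖₊ ≤ G.toNNReal := NNReal.le_toNNReal_of_coe_le (hG _ hω)
    have h2 : ‖T y (φ i ω)‖₊ / (2 * ε) ≤ (‖T (y - g) (φ i ω)‖₊ / ε + G.toNNReal / ε) / 2 := by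
      rw [← add_div, div_div, mul_comm 2]
      gcongr
      refine le_trans ?_ (add_le_add le_rfl h1)
      have h3 : T y (φ i ω) = T (y - g) (φ i ω) + T g (φ i ω) := by simp
      rw [h3]
      exact nnnorm_add_le _ _
    exact_mod_cast (ψ.monotone_toFun h2).trans (ψ.map_add_half_le _ _)
  calc ψ.modular μ (fun ω => T y (φ i ω)) (2 * ε)
      ≤ ∫⁻ ω, ((ψ (‖T (y - g) (φ i ω)‖₊ / ε) : ℝ≥0∞) + ψ (G.toNNReal / ε)) ∂μ :=
        lintegral_mono_ae hpt
    _ = ψ.modular μ (fun ω => T (y - g) (φ i ω)) ε + ψ (G.toNNReal / ε) := by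
      rw [lintegral_add_right _ measurable_const]
      simp [modular]
    _ ≤ 1 + ψ (G.toNNReal / ε) := by gcongr; exact hmod _ _ hyg i
    _ = _ := by push_cast; rfl

/-- A lower bound of the mean of `|f|` over a set bounds the modular from below. -/
theorem mul_measure_le_modular {f : Ω → ℂ} {S : Set Ω} {ε b : ℝ≥0} (hε : 0 < ε)
    (hb : 0 < b)
    (h : ((8 * ε * b : ℝ≥0) : ℝ≥0∞) * μ S ≤ ∫⁻ ω in S, ‖f ω‖ₑ ∂μ) :
    (ψ (2 * b) : ℝ≥0∞) * μ S ≤ ψ.modular μ f (2 * ε) := by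
  have hpt : ∀ ω, ((ψ (2 * b) / (2 * ε) : ℝ≥0) : ℝ≥0∞) * ‖f ω‖ₑ ≤
      ((2 * b : ℝ≥0) : ℝ≥0∞) * ((ψ (‖f ω‖₊ / (2 * ε)) : ℝ≥0∞) + ψ (2 * b)) := by
    intro ω
    have h1 := ψ.mul_map_le (2 * b) (‖f ω‖₊ / (2 * ε))
    rw [enorm_eq_nnnorm]
    norm_cast
    rw [div_mul_eq_mul_div, mul_comm (ψ _), ← div_mul_eq_mul_div]
    exact h1
  have h2 : ((ψ (2 * b) / (2 * ε) : ℝ≥0) : ℝ≥0∞) * (((8 * ε * b : ℝ≥0) : ℝ≥0∞) * μ S) ≤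
      ((2 * b : ℝ≥0) : ℝ≥0∞) * (ψ.modular μ f (2 * ε) + ψ (2 * b) * μ S) := by
    calc _ ≤ ((ψ (2 * b) / (2 * ε) : ℝ≥0) : ℝ≥0∞) * ∫⁻ ω in S, ‖f ω‖ₑ ∂μ := by gcongr
      _ = ∫⁻ ω in S, ((ψ (2 * b) / (2 * ε) : ℝ≥0) : ℝ≥0∞) * ‖f ω‖ₑ ∂μ :=
        (lintegral_const_mul' _ _ ENNReal.coe_ne_top).symm
      _ ≤ ∫⁻ ω in S, ((2 * b : ℝ≥0) : ℝ≥0∞) *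
          ((ψ (‖f ω‖₊ / (2 * ε)) : ℝ≥0∞) + ψ (2 * b)) ∂μ := lintegral_mono hpt
      _ = ((2 * b : ℝ≥0) : ℝ≥0∞) *
          (∫⁻ ω in S, (ψ (‖f ω‖₊ / (2 * ε)) : ℝ≥0∞) ∂μ + ψ (2 * b) * μ S) := by
        rw [lintegral_const_mul' _ _ ENNReal.coe_ne_top, lintegral_add_right _ measurable_const]
        simp
      _ ≤ _ := by gcongr; exact setLIntegral_le_lintegral _ _
  have h3 : ((ψ (2 * b) / (2 * ε) : ℝ≥0) : ℝ≥0∞) * (((8 * ε * b : ℝ≥0) : ℝ≥0∞) * μ S) =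
      ((2 * b : ℝ≥0) : ℝ≥0∞) * (ψ (2 * b) * μ S + ψ (2 * b) * μ S) := by
    rw [← two_mul, ← mul_assoc, ← mul_assoc, ← mul_assoc]
    congr 1
    norm_cast
    field_simp
    ring
  have hb2 : ((2 * b : ℝ≥0) : ℝ≥0∞) ≠ 0 := by simpa using hb.ne'
  rw [h3, ENNReal.mul_le_mul_iff_right hb2 ENNReal.coe_ne_top] at h2
  exact (ENNReal.add_le_add_iff_right
    (ENNReal.mul_ne_top ENNReal.coe_ne_top (measure_ne_top μ S))).1 h2

/-- A space of holomorphic functions normed by an Orlicz norm (with respect to one measure, or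
uniformly over a family of them) which charges the neighbourhoods of the boundary point `1` like
a measure of dimension `d` is not reflexive when `ψ` fails the `Δ₂`-condition. -/
theorem not_isReflexiveSpace_of_not_deltaTwo (hψ : ¬ ψ.DeltaTwo) {ι : Type*} {φ : ι → Ω → ℂ}
    {d : ℕ} (hd : d ≠ 0) (hφm : ∀ i, Measurable (φ i))
    (hφ : ∀ i, ∀ᵐ ω ∂μ, φ i ω ∈ Metric.ball (0 : ℂ) 1)
    (hmeas : ∀ i f, AEMeasurable (fun ω => T f (φ i ω)) μ)
    (hmod : ∀ (f : E) (c : ℝ≥0), ‖f‖ < c → ∀ i, ψ.modular μ (fun ω => T f (φ i ω)) c ≤ 1)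
    (hmem : ∀ g ∈ holomorphicDisc, ∀ K : ℝ≥0, 0 < K →
      (∀ i, ψ.modular μ (fun ω => g (φ i ω)) K ≤ 1) → ∃ f, T f = g ∧ ‖f‖ ≤ K)
    {C : ℝ≥0} (hint : ∀ δ : ℝ≥0, 0 < δ → δ ≤ 1 → ∀ i,
      ∫⁻ ω, ‖peak δ (φ i ω)‖ₑ ^ 4 ∂μ ≤ C * (δ : ℝ≥0∞) ^ d)
    {c : ℝ≥0} (hc : 0 < c) (hset : ∀ δ : ℝ≥0, 0 < δ → δ ≤ 1 → ∃ i S, MeasurableSet S ∧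
      c * (δ : ℝ≥0∞) ^ d ≤ μ S ∧ ∀ ω ∈ S, φ i ω ∈ Metric.ball (0 : ℂ) 1 ∧
        |(φ i ω).im| ≤ 1 / 25 * (1 - (φ i ω).re) ∧ 1 - (φ i ω).re ≤ δ) :
    ¬ IsReflexiveSpace E := by
  intro hE
  obtain ⟨x, hx, hx2, hx1, hx4⟩ := exists_lacunary_of_not_deltaTwo hψ
  obtain ⟨δ, hδ, hδ1, hδd⟩ := ψ.exists_scales hx1 hd
  have hF : ∀ N, ∃ f, T f = peakSum x δ N ∧ ‖f‖ ≤ (4 * (2 * C + 1) : ℝ≥0) := fun N =>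
    hmem _ (peakSum_mem_holomorphicDisc hδ N) _ (by positivity) fun i =>
      ψ.modular_peakSum_le_one μ (hφm i) (hφ i) hx hx2 hδ hδd
        (fun k => hint _ (hδ k) (hδ1 k) i) N
  choose F hTF hFn using hF
  obtain ⟨y, hy⟩ := hE.exists_tendsto_dual hFn
  let M : Submodule ℂ E :=
    { carrier := {f : E | ∃ G : ℝ, ∀ z ∈ Metric.ball (0 : ℂ) 1, ‖T f z‖ ≤ G}
      add_mem' := fun {f g} ⟨G, hG⟩ ⟨H, hH⟩ => ⟨G + H, fun z hz => by
        rw [map_add]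
        exact (norm_add_le _ _).trans (add_le_add (hG z hz) (hH z hz))⟩
      zero_mem' := ⟨0, fun z _ => by simp⟩
      smul_mem' := fun a f ⟨G, hG⟩ => ⟨‖a‖ * G, fun z hz => by
        rw [map_smul, Pi.smul_apply, norm_smul]
        exact mul_le_mul_of_nonneg_left (hG z hz) (norm_nonneg a)⟩ }
  have hyM : y ∈ M.topologicalClosure := Submodule.mem_topologicalClosure_of_tendsto_dual
    (M := M) (x := F) (fun N => ⟨_, fun z hz => by
      rw [hTF N]
      exact norm_peakSum_le_sum hδ N hz⟩) hy
  set ε : ℝ≥0 := 1 / 16 * (1 / 3) ^ 8 with hε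
  have hε0 : 0 < ε := by positivity
  obtain ⟨B, hB⟩ := exists_modular_le_of_mem_closure T μ hφ hmod hyM hε0
  have hlow : ∀ n, c * 2 ^ n ≤ B := by
    intro n
    obtain ⟨i, S, hS, hμS, hSφ⟩ := hset (δ n) (hδ n) (hδ1 n)
    obtain ⟨hTint, l, hl⟩ := exists_dual_eq_setIntegral T μ (hmeas i) (fun f c h => hmod f c h i) S
    have hre : (8 * ε * x n : ℝ≥0) * μ.real S ≤ (l y).re := by
      refine ge_of_tendsto ((Complex.continuous_re.tendsto _).comp (hy l))
        ((show ∀ᶠ N in (hyperfilter ℕ : Filter ℕ), n < N from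
          Nat.hyperfilter_le_atTop (eventually_gt_atTop n)).mono fun N hN => ?_)
      have hsw : (l (F N)).re = ∫ ω in S, (T (F N) (φ i ω)).re ∂μ := by
        rw [hl]
        exact (integral_re (hTint (F N)).integrableOn).symm
      rw [Function.comp_apply, hsw]
      refine le_trans (le_of_eq ?_) (setIntegral_mono_on (f := fun _ => ((8 * ε * x n : ℝ≥0) : ℝ))
        integrableOn_const (hTint (F N)).re.integrableOn hS fun ω hω => ?_)
      · rw [setIntegral_const, smul_eq_mul, mul_comm]
      · rw [hTF N]
        obtain ⟨h1, h2, h3⟩ := hSφ ω hω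
        refine le_trans (le_of_eq ?_) (le_re_peakSum hδ hN h1 h2 h3)
        rw [hε]
        push_cast
        ring
    have h1 : ((8 * ε * x n : ℝ≥0) : ℝ≥0∞) * μ S ≤ ∫⁻ ω in S, ‖T y (φ i ω)‖ₑ ∂μ := by
      refine le_trans ?_ (enorm_integral_le_lintegral_enorm _)
      rw [← hl y, ← ofReal_norm]
      refine le_trans (le_of_eq ?_) (ENNReal.ofReal_le_ofReal (hre.trans (Complex.re_le_norm _)))
      rw [ENNReal.ofReal_mul (NNReal.coe_nonneg _), ENNReal.ofReal_coe_nnreal, ofReal_measureReal]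
    have h2 := (mul_measure_le_modular (ψ := ψ) μ hε0 (hx n) h1).trans (hB i)
    have h3 : (ψ (2 * x n) : ℝ≥0∞) * (c * (δ n : ℝ≥0∞) ^ d) ≤ B := le_trans (by gcongr) h2
    have h4 : ψ (2 * x n) * (c * δ n ^ d) ≤ B := by exact_mod_cast h3
    refine le_trans ?_ h4
    calc c * 2 ^ n = 4 ^ n * ψ (x n) * (c * δ n ^ d) := by
          have h5 : (4 : ℝ≥0) ^ n * 2⁻¹ ^ n = 2 ^ n := by rw [← mul_pow]; norm_num
          rw [← h5, ← hδd n]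
          ring
      _ ≤ _ := by gcongr; exact hx4 n
  obtain ⟨n, hn⟩ := pow_unbounded_of_one_lt (B / c) (one_lt_two : (1 : ℝ≥0) < 2)
  rw [div_lt_iff₀' hc] at hn
  exact absurd (hlow n) (not_le.2 hn)

end OrliczFunction

instance : IsProbabilityMeasure circleMeasure := ⟨by
  rw [circleMeasure, Measure.smul_apply, Measure.restrict_apply_univ, Real.volume_Ioc, smul_eq_mul,
    ← ENNReal.ofReal_mul (by positivity), sub_zero, one_div_mul_cancel (by positivity),
    ENNReal.ofReal_one]⟩

theorem discMeasure_apply_of_subset {S : Set ℂ} (hS : MeasurableSet S)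
    (h : S ⊆ Metric.ball 0 1) : discMeasure S = ENNReal.ofReal (1 / Real.pi) * volume S := by
  rw [discMeasure, Measure.smul_apply, Measure.restrict_apply hS, inter_eq_left.2 h, smul_eq_mul]

theorem discMeasure_ball {a : ℂ} {r : ℝ≥0} (h : Metric.ball a r ⊆ Metric.ball 0 1) :
    discMeasure (Metric.ball a r) = (r : ℝ≥0∞) ^ 2 := by
  rw [discMeasure_apply_of_subset measurableSet_ball h, Complex.volume_ball,
    ENNReal.ofReal_coe_nnreal, mul_left_comm, ← ENNReal.ofReal_coe_nnreal (p := NNReal.pi),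
    ← ENNReal.ofReal_mul (by positivity), NNReal.coe_real_pi, one_div_mul_cancel Real.pi_ne_zero,
    ENNReal.ofReal_one, mul_one]

theorem ae_discMeasure_mem_ball : ∀ᵐ z ∂discMeasure, z ∈ Metric.ball (0 : ℂ) 1 :=
  (ae_restrict_mem measurableSet_ball).filter_mono
    (Measure.ae_mono' (Measure.smul_absolutelyContinuous))

instance : IsProbabilityMeasure discMeasure := ⟨by
  have h1 := discMeasure_ball (a := 0) (r := 1) (by simp)
  rw [NNReal.coe_one, ENNReal.coe_one, one_pow] at h1
  rw [← h1]
  exact (measure_eq_measure_of_null_sdiff (subset_univ _)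
    (by rw [← compl_eq_univ_sdiff]; exact ae_discMeasure_mem_ball)).symm⟩

/-- Powers of the peak function are controlled by the Poisson kernel. -/
theorem norm_peak_pow_four_le {δ : ℝ} (hδ : 0 < δ) {z : ℂ} (hz : z ∈ Metric.ball (0 : ℂ) 1) :
    ‖peak δ z‖ ^ 4 ≤ δ * ((1 + δ + z) / (1 + δ - z)).re := by
  have hz1 := re_le_one_of_mem_ball hz
  have hp := norm_peak_le_one hδ hz1
  have hn : 0 < Complex.normSq (1 + δ - z) :=
    Complex.normSq_pos.2 (one_add_sub_ne_zero hδ hz1)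
  refine (pow_le_pow_of_le_one (norm_nonneg _) hp (by norm_num : 2 ≤ 4)).trans ?_
  have hzn : Complex.normSq z ≤ 1 := by
    rw [← Complex.sq_norm]
    exact pow_le_one₀ (norm_nonneg _) (mem_ball_zero_iff.1 hz).le
  rw [peak, norm_div, div_pow, Complex.sq_norm (1 + δ - z), Complex.norm_real,
    Real.norm_of_nonneg hδ.le, Complex.div_re, ← add_div, ← mul_div_assoc]
  gcongr
  rw [Complex.normSq_apply] at hzn
  simp
  nlinarith

theorem lintegral_circleMeasure {f : ℝ → ℝ} (hf : Continuous f) (h0 : ∀ t, 0 ≤ f t) :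
    ∫⁻ t, ENNReal.ofReal (f t) ∂circleMeasure =
      ENNReal.ofReal ((2 * Real.pi)⁻¹ * ∫ t in (0 : ℝ)..2 * Real.pi, f t) := by
  rw [circleMeasure, lintegral_smul_measure, intervalIntegral.integral_of_le (by positivity),
    ENNReal.ofReal_mul (by positivity), one_div, smul_eq_mul,
    ofReal_integral_eq_lintegral_ofReal (hf.integrableOn_Ioc) (ae_of_all _ h0)]

theorem circleMap_mem_unitBall {r : ℝ} (hr : r ∈ Ioo (0 : ℝ) 1) (t : ℝ) :
    circleMap 0 r t ∈ Metric.ball (0 : ℂ) 1 := by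
  simp [abs_of_pos hr.1, hr.2]

theorem lintegral_peak_circle_le {δ : ℝ≥0} (hδ : 0 < δ) {r : ℝ} (hr : r ∈ Ioo (0 : ℝ) 1) :
    ∫⁻ t, ‖peak δ (circleMap 0 r t)‖ₑ ^ 4 ∂circleMeasure ≤ δ := by
  have hδ' : (0 : ℝ) < δ := hδ
  set g : ℂ → ℂ := fun z => (1 + (δ : ℝ) + z) / (1 + (δ : ℝ) - z) with hg
  have hgd : DifferentiableOn ℂ g {z | z.re ≤ 1} := by
    refine DifferentiableOn.div (by fun_prop) (by fun_prop) fun z hz => ?_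
    exact one_add_sub_ne_zero hδ' hz
  have hball : ∀ z ∈ Metric.closedBall (0 : ℂ) |r|, z.re ≤ 1 := fun z hz => by
    rw [abs_of_pos hr.1] at hz
    exact re_le_one_of_mem_ball (Metric.closedBall_subset_ball hr.2 hz)
  have hcont : Continuous fun t => g (circleMap 0 r t) :=
    hgd.continuousOn.comp_continuous (continuous_circleMap 0 r)
      fun t => re_le_one_of_mem_ball (circleMap_mem_unitBall hr t)
  have havg : Real.circleAverage g 0 r = 1 := by
    rw [DiffContOnCl.circleAverage ((hgd.mono fun z hz => hball z hz).diffContOnCl_ball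
      (Subset.refl _))]
    simp only [hg, add_zero, sub_zero]
    refine div_self ?_
    exact_mod_cast (add_pos one_pos hδ').ne'
  have hre : (2 * Real.pi)⁻¹ * ∫ t in (0 : ℝ)..2 * Real.pi, (g (circleMap 0 r t)).re = 1 := by
    have h1 := congrArg Complex.re havg
    rw [Real.circleAverage, Complex.real_smul, Complex.re_ofReal_mul, Complex.one_re] at h1
    rw [← h1]
    congr 1
    exact intervalIntegral.intervalIntegral_re (hcont.intervalIntegrable _ _)
  have hpt := fun t => norm_peak_pow_four_le hδ' (circleMap_mem_unitBall hr t)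
  calc ∫⁻ t, ‖peak δ (circleMap 0 r t)‖ₑ ^ 4 ∂circleMeasure
      ≤ ∫⁻ t, ENNReal.ofReal (δ * (g (circleMap 0 r t)).re) ∂circleMeasure := by
        refine lintegral_mono fun t => ?_
        rw [← ofReal_norm, ← ENNReal.ofReal_pow (norm_nonneg _)]
        exact ENNReal.ofReal_le_ofReal (hpt t)
    _ = δ := by
      rw [lintegral_circleMeasure (f := fun t => δ * (g (circleMap 0 r t)).re)
        ((Complex.continuous_re.comp hcont).const_mul _)
        (fun t => le_trans (by positivity) (hpt t)), intervalIntegral.integral_const_mul,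
        mul_left_comm, hre, mul_one, ENNReal.ofReal_coe_nnreal]

theorem norm_peak_pow_four_le_one_add_norm {δ : ℝ} (hδ : 0 < δ) {z : ℂ} (hz : z.re ≤ 1) :
    ‖peak δ z‖ ^ 4 ≤ 4 * (1 + ‖δ⁻¹ • (1 - z)‖) ^ (-4 : ℝ) := by
  have hn : 0 < ‖1 + δ - z‖ := norm_pos_iff.2 (one_add_sub_ne_zero hδ hz)
  have h1 : (δ + ‖1 - z‖) ^ 2 ≤ 2 * ‖1 + δ - z‖ ^ 2 := by
    have e1 : ‖1 - z‖ ^ 2 = (1 - z.re) ^ 2 + z.im ^ 2 := by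
      rw [Complex.sq_norm, Complex.normSq_apply]; simp; ring
    have e2 : ‖1 + δ - z‖ ^ 2 = (δ + (1 - z.re)) ^ 2 + z.im ^ 2 := by
      rw [Complex.sq_norm, Complex.normSq_apply, re_one_add_sub]; simp; ring
    nlinarith [sq_nonneg (δ - ‖1 - z‖), mul_nonneg hδ.le (sub_nonneg.2 hz)]
  have h2 : (δ + ‖1 - z‖) ^ 4 ≤ 4 * ‖1 + δ - z‖ ^ 4 := by
    have := pow_le_pow_left₀ (sq_nonneg _) h1 2
    nlinarith
  have h3 : 1 + ‖δ⁻¹ • (1 - z)‖ = (δ + ‖1 - z‖) / δ := by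
    rw [norm_smul, norm_inv, Real.norm_of_nonneg hδ.le]
    field_simp
  have h4 : 0 < δ + ‖1 - z‖ := add_pos_of_pos_of_nonneg hδ (norm_nonneg _)
  rw [h3, Real.rpow_neg (by positivity), peak, norm_div, Complex.norm_real,
    Real.norm_of_nonneg hδ.le, div_pow]
  norm_cast
  push_cast
  rw [div_pow, inv_div, ← mul_div_assoc, div_le_div_iff₀ (by positivity) (by positivity)]
  nlinarith [mul_le_mul_of_nonneg_left h2 (by positivity : 0 ≤ δ ^ 4)]

theorem exists_lintegral_peak_disc_le : ∃ C : ℝ≥0, ∀ δ : ℝ≥0, 0 < δ →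
    ∫⁻ z, ‖peak δ z‖ₑ ^ 4 ∂discMeasure ≤ C * (δ : ℝ≥0∞) ^ 2 := by
  set h : ℂ → ℝ≥0∞ := fun v => ENNReal.ofReal (4 * (1 + ‖v‖) ^ (-4 : ℝ)) with hh
  have hm : Measurable h := by fun_prop
  have hfin : ∫⁻ v, h v ≠ ⊤ := by
    have hi : Integrable (fun v : ℂ => 4 * (1 + ‖v‖) ^ (-4 : ℝ)) :=
      (integrable_one_add_norm (by rw [Complex.finrank_real_complex]; norm_num)).const_mul 4
    exact hi.lintegral_lt_top.ne
  refine ⟨(ENNReal.ofReal (1 / Real.pi) * ∫⁻ v, h v).toNNReal, fun δ hδ => ?_⟩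
  have hδ' : (0 : ℝ) < δ := hδ
  rw [ENNReal.coe_toNNReal (ENNReal.mul_ne_top ENNReal.ofReal_ne_top hfin), discMeasure,
    lintegral_smul_measure, smul_eq_mul, mul_assoc]
  gcongr
  calc ∫⁻ z in Metric.ball 0 1, ‖peak δ z‖ₑ ^ 4
      ≤ ∫⁻ z in Metric.ball 0 1, h ((δ : ℝ)⁻¹ • (1 - z)) := by
        refine setLIntegral_mono (by fun_prop) fun z hz => ?_
        rw [← ofReal_norm, ← ENNReal.ofReal_pow (norm_nonneg _)]
        exact ENNReal.ofReal_le_ofReal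
          (norm_peak_pow_four_le_one_add_norm hδ' (re_le_one_of_mem_ball hz))
    _ ≤ ∫⁻ z, h ((δ : ℝ)⁻¹ • (1 - z)) := setLIntegral_le_lintegral _ _
    _ = ∫⁻ z, h ((δ : ℝ)⁻¹ • z) := lintegral_sub_left_eq_self (fun z => h ((δ : ℝ)⁻¹ • z)) 1
    _ = ∫⁻ v, h v ∂(Measure.map (fun z : ℂ => (δ : ℝ)⁻¹ • z) volume) :=
        (lintegral_map hm (by fun_prop)).symm
    _ = (∫⁻ v, h v) * (δ : ℝ≥0∞) ^ 2 := by
      rw [Measure.map_addHaar_smul _ (inv_ne_zero hδ'.ne'), lintegral_smul_measure,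
        Complex.finrank_real_complex, smul_eq_mul, mul_comm, inv_pow, inv_inv,
        abs_of_pos (by positivity), ENNReal.ofReal_pow hδ'.le, ENNReal.ofReal_coe_nnreal]

theorem exists_circle_near_one {δ : ℝ≥0} (hδ : 0 < δ) (hδ1 : δ ≤ 1) :
    ∃ r ∈ Ioo (0 : ℝ) 1, ∃ S : Set ℝ, MeasurableSet S ∧
      (1 / 400 : ℝ≥0) * (δ : ℝ≥0∞) ≤ circleMeasure S ∧ ∀ t ∈ S,
        |(circleMap 0 r t).im| ≤ 1 / 25 * (1 - (circleMap 0 r t).re) ∧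
          1 - (circleMap 0 r t).re ≤ δ := by
  have hδ' : (0 : ℝ) < δ := hδ
  have hδ1' : (δ : ℝ) ≤ 1 := hδ1
  have hr : (1 - δ / 2 : ℝ) ∈ Ioo (0 : ℝ) 1 := ⟨by linarith, by linarith⟩
  have hpi := Real.pi_gt_three
  have hpi4 := Real.pi_le_four
  refine ⟨1 - δ / 2, hr, Ioc 0 (δ / 50), measurableSet_Ioc, ?_, fun t ht => ?_⟩
  · rw [circleMeasure, Measure.smul_apply, Measure.restrict_apply measurableSet_Ioc,
      inter_eq_left.2 (Ioc_subset_Ioc_right (by linarith)), Real.volume_Ioc, smul_eq_mul,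
      ← ENNReal.ofReal_mul (by positivity), ← ENNReal.ofReal_coe_nnreal,
      ← ENNReal.ofReal_coe_nnreal, ← ENNReal.ofReal_mul (by positivity)]
    refine ENNReal.ofReal_le_ofReal ?_
    push_cast
    rw [sub_zero, div_mul_div_comm, one_mul, div_mul_eq_mul_div, one_mul]
    refine div_le_div_of_nonneg_left hδ'.le (by positivity) (by linarith)
  · have hre : (circleMap 0 (1 - δ / 2) t).re = (1 - δ / 2) * Real.cos t := by
      rw [circleMap_zero, Complex.re_ofReal_mul, Complex.exp_ofReal_mul_I_re]
    have him : (circleMap 0 (1 - δ / 2) t).im = (1 - δ / 2) * Real.sin t := by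
      rw [circleMap_zero, Complex.im_ofReal_mul, Complex.exp_ofReal_mul_I_im]
    have hsin : |Real.sin t| ≤ t := (Real.abs_sin_le_abs).trans_eq (abs_of_pos ht.1)
    have hcos := Real.one_sub_sq_div_two_le_cos (x := t)
    have hcos1 := Real.cos_le_one t
    have ht2 := ht.2
    have ht0 := ht.1
    rw [hre, him, abs_mul, abs_of_pos hr.1]
    constructor
    · nlinarith [hr.1, hr.2]
    · nlinarith [hr.1, hr.2]

theorem exists_disc_near_one {δ : ℝ≥0} (hδ : 0 < δ) (hδ1 : δ ≤ 1) :
    ∃ S : Set ℂ, MeasurableSet S ∧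
      ((1 / 100) ^ 2 : ℝ≥0) * (δ : ℝ≥0∞) ^ 2 ≤ discMeasure S ∧ ∀ z ∈ S,
        z ∈ Metric.ball (0 : ℂ) 1 ∧ |z.im| ≤ 1 / 25 * (1 - z.re) ∧ 1 - z.re ≤ δ := by
  have hδ' : (0 : ℝ) < δ := hδ
  have hδ1' : (δ : ℝ) ≤ 1 := hδ1
  have hsub : Metric.ball ((1 - δ / 2 : ℝ) : ℂ) ((1 / 100 * δ : ℝ≥0) : ℝ) ⊆
      Metric.ball 0 1 := by
    refine Metric.ball_subset_ball' ?_
    rw [dist_zero_right, Complex.norm_real, Real.norm_of_nonneg (by linarith)]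
    push_cast
    linarith
  refine ⟨_, measurableSet_ball, (le_of_eq ?_).trans (discMeasure_ball hsub).ge,
    fun z hz => ⟨hsub hz, ?_⟩⟩
  · rw [ENNReal.coe_pow, ← mul_pow, ENNReal.coe_mul]
  · rw [mem_ball_iff_norm] at hz
    push_cast at hz
    have h1 := (Complex.abs_re_le_norm _).trans hz.le
    have h2 := (Complex.abs_im_le_norm _).trans hz.le
    simp at h1 h2
    rw [abs_le] at h1
    constructor <;> linarith [h1.1, h1.2]

theorem HardyOrlicz.not_isReflexiveSpace {ψ : OrliczFunction} (hψ : ¬ ψ.DeltaTwo) :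
    ¬ IsReflexiveSpace (HardyOrlicz ψ) := by
  let T : HardyOrlicz ψ →ₗ[ℂ] (ℂ → ℂ) :=
    { toFun := fun f => f.1
      map_add' := fun _ _ => rfl
      map_smul' := fun _ _ => rfl }
  refine OrliczFunction.not_isReflexiveSpace_of_not_deltaTwo T circleMeasure hψ
    (φ := fun r : Ioo (0 : ℝ) 1 => circleMap 0 r) one_ne_zero
    (fun r => (continuous_circleMap 0 r).measurable)
    (fun r => ae_of_all _ fun t => circleMap_mem_unitBall r.2 t)
    (fun r f => (holomorphicDisc.continuous_circle f.2.1 r.2).measurable.aemeasurable)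
    (fun f c hc r => ψ.modular_le_one_of_luxemburg_lt _ ?_)
    (fun g hg K hK h => ?_) (C := 1) (fun δ hδ _ r => ?_) (c := 1 / 400) (by positivity)
    fun δ hδ hδ1 => ?_
  · refine lt_of_le_of_lt (le_iSup₂ (f := fun r (_ : r ∈ Ioo (0 : ℝ) 1) =>
      ψ.luxemburg circleMeasure fun t => f.1 (circleMap 0 r t)) r.1 r.2) ?_
    have h1 : (hardyOrliczENorm ψ f.1).toReal < c := hc
    rw [← ENNReal.coe_toReal, ENNReal.toReal_lt_toReal f.2.2.ne ENNReal.coe_ne_top] at h1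
    exact h1
  · have h1 : hardyOrliczENorm ψ g ≤ K :=
      iSup₂_le fun r hr => ψ.luxemburg_le _ hK (h ⟨r, hr⟩)
    exact ⟨⟨g, hg, h1.trans_lt ENNReal.coe_lt_top⟩, rfl, ENNReal.toReal_le_coe_of_le_coe h1⟩
  · simpa using lintegral_peak_circle_le hδ r.2
  · obtain ⟨r, hr, S, hS, hμ, h⟩ := exists_circle_near_one hδ hδ1
    exact ⟨⟨r, hr⟩, S, hS, by simpa using hμ, fun t ht => ⟨circleMap_mem_unitBall hr t, h t ht⟩⟩

theorem BergmanOrlicz.not_isReflexiveSpace {ψ : OrliczFunction} (hψ : ¬ ψ.DeltaTwo) :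
    ¬ IsReflexiveSpace (BergmanOrlicz ψ) := by
  let T : BergmanOrlicz ψ →ₗ[ℂ] (ℂ → ℂ) :=
    { toFun := fun f => f.1
      map_add' := fun _ _ => rfl
      map_smul' := fun _ _ => rfl }
  obtain ⟨C, hC⟩ := exists_lintegral_peak_disc_le
  refine OrliczFunction.not_isReflexiveSpace_of_not_deltaTwo T discMeasure hψ
    (φ := fun (_ : Unit) z => z) two_ne_zero (fun _ => measurable_id)
    (fun _ => ae_discMeasure_mem_ball) (fun _ f => holomorphicDisc.aemeasurable f.2.1)
    (fun f c hc _ => ψ.modular_le_one_of_luxemburg_lt _ ?_)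
    (fun g hg K hK h => ?_) (fun δ hδ _ _ => hC δ hδ) (c := (1 / 100) ^ 2) (by positivity)
    fun δ hδ hδ1 => ⟨(), exists_disc_near_one hδ hδ1⟩
  · have h1 : (bergmanOrliczENorm ψ f.1).toReal < c := hc
    rw [← ENNReal.coe_toReal, ENNReal.toReal_lt_toReal f.2.2.ne ENNReal.coe_ne_top] at h1
    exact h1
  · have h1 : bergmanOrliczENorm ψ g ≤ K := ψ.luxemburg_le _ hK (h ())
    exact ⟨⟨g, hg, h1.trans_lt ENNReal.coe_lt_top⟩, rfl, ENNReal.toReal_le_coe_of_le_coe h1⟩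

theorem mainTheorem6 (ψ : OrliczFunction) (hψ : ¬ ψ.DeltaTwo) :
    ¬ IsReflexiveSpace (HardyOrlicz ψ) ∧ ¬ IsReflexiveSpace (BergmanOrlicz ψ) :=
  ⟨HardyOrlicz.not_isReflexiveSpace hψ, BergmanOrlicz.not_isReflexiveSpace hψ⟩
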